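/- For integers $n,p\ge 1$ consider the linear regression model $Y_i=\sum_{j=1}^p\theta_jX_{ij}+\xi_i$, $1\le i\le n$, where the $X_{ij}$ are i.i.d. $\mathcal N(0,1)$, the $\xi_i$ are i.i.d. $\mathcal N(0,\sigma^2)$ and independent of $X=(X_{ij})$, and $\sigma>0$ is unknown. Let $P_{\theta,\sigma}$ be the law of the observation $Z=(X,Y)$ and $E_{\theta,\sigma}$ the expectation under it. For real $k$ and $r$ let $\Theta_k(r)$ be the set of $\theta\in\mathbb R^p$ that have at most $k$ nonzero coordinates and Euclidean norm $\|\theta\|\ge r$. The minimax total error probability with unknown variance is $$\gamma^{un}_{n,p,k}(r)=\inf_{\psi}\Big[\sup_{\sigma>0}E_{0,\sigma}(\psi)+\sup_{\theta\in\Theta_k(r),\ \sigma>0}E_{\sigma\theta,\sigma}(1-\psi)\Big],$$ where the infimum is over all measurable functions $\psi=\psi(Z)$ with values in $[0,1]$. For $1/2<\beta<1$ put $\varphi(\beta)=\sqrt{2\beta-1}$ if $\beta\le 3/4$ and $\varphi(\beta)=\sqrt2\,(1-\sqrt{1-\beta})$ if $\beta>3/4$. **Theorem.** Fix $\beta\in(1/2,1]$.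 Let $n\to\infty$ and $p\to\infty$ (along arbitrary sequences), and let $k=p^{1-\beta}$. 1. Suppose that $\beta<1$ and $k\log p=o(n)$, and let $r_{np}=x_{n,p}\sqrt{k\log(p)/n}$ with real numbers $x_{n,p}$ such that $\limsup\,(x_{n,p}-\varphi(\beta))<0$. Then $\gamma^{un}_{n,p,k}(r_{np})\to 1$. 2. Suppose that $k\log(p)/n\to\infty$. Then $\gamma^{un}_{n,p,k}(r)\to1$ for every fixed $r>0$. -/

import Mathlib

open Filter Topology Asymptotics MeasureTheory ProbabilityTheory
open scoped NNReal

namespace SparseDetection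

noncomputable section

/-- Observations `Z = (X, Y)`: the `n × p` design matrix and the response vector. -/
abbrev Obs (n p : ℕ) : Type := (Fin n → Fin p → ℝ) × (Fin n → ℝ)

/-- Law of the design matrix: the entries `X i j` are i.i.d. standard Gaussian. -/
def designLaw (n p : ℕ) : Measure (Fin n → Fin p → ℝ) :=
  Measure.pi fun _ => Measure.pi fun _ => gaussianReal 0 1

/-- Law of the noise vector: the `ξ i` are i.i.d. centred Gaussian with variance `σ ^ 2`. -/
def noiseLaw (n : ℕ) (σ : ℝ) : Measure (Fin n → ℝ) :=
  Measure.pi fun _ => gaussianReal 0 (Real.toNNReal (σ ^ 2))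

/-- `P_{θ,σ}`, the law of `Z = (X, Y)` with `Y i = ∑ j, θ j * X i j + ξ i`,
where the noise `ξ` is independent of the design `X`. -/
def obsLaw (n p : ℕ) (θ : EuclideanSpace ℝ (Fin p)) (σ : ℝ) : Measure (Obs n p) :=
  ((designLaw n p).prod (noiseLaw n σ)).map
    fun w => (w.1, fun i => (∑ j, θ j * w.1 i j) + w.2 i)

/-- `M(θ)`, the number of nonzero coordinates of `θ`. -/
def numNonzero {p : ℕ} (θ : EuclideanSpace ℝ (Fin p)) : ℕ :=
  (Finset.univ.filter fun j => θ j ≠ 0).card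

/-- `Θ_k(r)`: vectors with at most `k` nonzero coordinates and Euclidean norm at least `r`.
The radius `k` of the `ℓ₀` ball is a real number, because it will be `p ^ (1 - β)`. -/
def alternatives (p : ℕ) (k r : ℝ) : Set (EuclideanSpace ℝ (Fin p)) :=
  {θ | (numNonzero θ : ℝ) ≤ k ∧ r ≤ ‖θ‖}

/-- Tests: measurable functions of the observations with values in `[0, 1]`. -/
def tests (n p : ℕ) : Set (Obs n p → ℝ) :=
  {ψ | Measurable ψ ∧ ∀ z, ψ z ∈ Set.Icc (0 : ℝ) 1}

/-- Type I error probability under unknown variance, `sup_{σ > 0} E_{0,σ} ψ`. -/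
def typeIError {n p : ℕ} (ψ : Obs n p → ℝ) : ℝ :=
  ⨆ σ : Set.Ioi (0 : ℝ), ∫ z, ψ z ∂(obsLaw n p 0 σ)

/-- Type II error probability under unknown variance,
`sup_{θ ∈ Θ, σ > 0} E_{σθ,σ} (1 - ψ)`. -/
def typeIIError {n p : ℕ} (ψ : Obs n p → ℝ) (Θ : Set (EuclideanSpace ℝ (Fin p))) : ℝ :=
  ⨆ q : Θ × Set.Ioi (0 : ℝ),
    ∫ z, (1 - ψ z) ∂(obsLaw n p ((q.2 : ℝ) • (q.1 : EuclideanSpace ℝ (Fin p))) q.2)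

/-- Minimax total error probability under unknown variance: the infimum over all tests of the
sum of the two error probabilities, for the alternative `Θ_k(r)`.
All suprema and infima of reals here are over families with values in `[0, 2]`. -/
def minimaxError (n p : ℕ) (k r : ℝ) : ℝ :=
  ⨅ ψ : tests n p,
    (typeIError (ψ : Obs n p → ℝ) + typeIIError (ψ : Obs n p → ℝ) (alternatives p k r))

/-- The function `φ` of the sharp detection boundary; it is used for `1/2 < β < 1`. -/
def boundaryConst (β : ℝ) : ℝ :=
  if β ≤ 3 / 4 then √(2 * β - 1) else √2 * (1 - √(1 - β))

/-- The sparsity `k = p ^ (1 - β)`. -/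
def sparsity (β : ℝ) (p : ℕ) : ℝ := (p : ℝ) ^ (1 - β)

end

end SparseDetection

namespace SparseDetection

/-! The argument is the Bayesian second moment method. The null is `P_{0,1}`. The alternative is a
uniform mixture of laws with coefficient `h` on a random support `S` of size `m` and noise variance
`v = 1 - m * h ^ 2`. This is where the unknown variance enters: with this `v` each response is again
standard Gaussian, so the signal is invisible in `Y` alone. Two supports that share `T` coordinates
then have cross moment `(1 - h ^ 2 * T)⁻¹ ^ n` of their likelihood ratios. If the averaged
likelihood ratio has second moment tending to one, no test beats a total error of one
(`one_sub_sqrt_le_error`).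

The support takes one coordinate from each of `m` blocks of size `q`, with `m` about `k` and `q`
about `p / k`. The overlap of two such supports is binomial, so a bound `exp (c * T)` on the cross
moments averages to at most `exp (m * exp c / q)` (`sum_exp_agreements_le`). As `m / q` is of order
`p ^ (1 - 2 * β)`, any `c ≤ B * log p` with `B < 2 * β - 1` suffices.

For fixed `r` one takes `v = 1 / (1 + r ^ 2)`, and `c` is of order `n / k`, negligible against `log
p`. For shrinking radii `h ^ 2 = x ^ 2 * log p / n`, so `c` is about `x ^ 2 * log p`, which settles
`x < √(2 * β - 1)`. For `β > 3/4` rare large correlations inflate the second moment. The likelihood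
ratios are therefore restricted to the event that `∑ i, X i j * Y i ≤ √(2 * n * log p)` for all `j ∈
S` (`minimaxError_lower_bound_truncated`). Chernoff bounds for the loss of mass and for the
truncated second moment then both require `x < √2 * (1 - √(1 - β))`. -/

/-! ### Gaussian densities and exponentials of quadratic forms. -/

/-- The density of `N(u, v)` with respect to `N(0, 1)`. -/
noncomputable def gaussRatio (v u y : ℝ) : ℝ :=
  (√v)⁻¹ * Real.exp (y ^ 2 / 2 - (y - u) ^ 2 / (2 * v))

lemma gaussRatio_nonneg (v u y : ℝ) : 0 ≤ gaussRatio v u y := by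
  unfold gaussRatio; positivity

@[fun_prop]
lemma measurable_gaussRatio {α : Type*} [MeasurableSpace α] {v : ℝ} {u y : α → ℝ}
    (hu : Measurable u) (hy : Measurable y) : Measurable fun a => gaussRatio v (u a) (y a) := by
  unfold gaussRatio; fun_prop

/-- Completing the square turns the integrand times the standard density into a multiple of the
density of `N(b / (1 + a), 1 / (1 + a))`. -/
lemma lintegral_exp_quadratic {a : ℝ} (ha : 0 < 1 + a) (b : ℝ) :
    ∫⁻ g, ENNReal.ofReal (Real.exp (b * g - a * g ^ 2 / 2)) ∂(gaussianReal 0 1) =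
      ENNReal.ofReal ((√(1 + a))⁻¹ * Real.exp (b ^ 2 / (2 * (1 + a)))) := by
  have hv : Real.toNNReal ((1 + a)⁻¹) ≠ 0 := by simpa using ha
  have h1 : ((Real.toNNReal ((1 + a)⁻¹) : ℝ≥0) : ℝ) = (1 + a)⁻¹ :=
    Real.coe_toNNReal _ (inv_nonneg.2 ha.le)
  rw [gaussianReal_of_var_ne_zero 0 one_ne_zero,
    lintegral_withDensity_eq_lintegral_mul _ (measurable_gaussianPDF 0 1) (by fun_prop)]
  have : ∀ g, (gaussianPDF 0 1 * fun g => ENNReal.ofReal (Real.exp (b * g - a * g ^ 2 / 2))) g =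
      ENNReal.ofReal ((√(1 + a))⁻¹ * Real.exp (b ^ 2 / (2 * (1 + a)))) *
        gaussianPDF (b / (1 + a)) (Real.toNNReal ((1 + a)⁻¹)) g := by
    intro g
    simp only [Pi.mul_apply, gaussianPDF]
    rw [← ENNReal.ofReal_mul (gaussianPDFReal_nonneg _ _ _), ← ENNReal.ofReal_mul (by positivity)]
    congr 1
    simp only [gaussianPDFReal, h1, NNReal.coe_one, mul_one, sub_zero]
    have hs : √(2 * Real.pi * (1 + a)⁻¹) = √(2 * Real.pi) * (√(1 + a))⁻¹ := by
      rw [Real.sqrt_mul (by positivity), Real.sqrt_inv]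
    have hs0 : 0 < √(1 + a) := Real.sqrt_pos.2 ha
    rw [hs, mul_assoc, ← Real.exp_add]
    rw [show (√(1 + a))⁻¹ * Real.exp (b ^ 2 / (2 * (1 + a))) * ((√(2 * Real.pi) * (√(1 + a))⁻¹)⁻¹ *
      Real.exp (-(g - b / (1 + a)) ^ 2 / (2 * (1 + a)⁻¹))) = (√(2 * Real.pi))⁻¹ *
      (Real.exp (b ^ 2 / (2 * (1 + a))) * Real.exp (-(g - b / (1 + a)) ^ 2 / (2 * (1 + a)⁻¹))) by
        field_simp, ← Real.exp_add]
    congr 2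
    field_simp
    ring
  simp_rw [this]
  rw [lintegral_const_mul _ (measurable_gaussianPDF _ _), lintegral_gaussianPDF_eq_one _ hv, mul_one]

lemma gaussianReal_eq_withDensity {v : ℝ} (hv : 0 < v) (u : ℝ) :
    gaussianReal u v.toNNReal =
      (gaussianReal 0 1).withDensity fun y => ENNReal.ofReal (gaussRatio v u y) := by
  have hv' : v.toNNReal ≠ 0 := by simpa using hv
  rw [gaussianReal_of_var_ne_zero 0 one_ne_zero, gaussianReal_of_var_ne_zero u hv',
    ← withDensity_mul _ (measurable_gaussianPDF 0 1) (by fun_prop)]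
  congr 1
  ext y
  simp only [Pi.mul_apply, gaussianPDF]
  rw [← ENNReal.ofReal_mul (gaussianPDFReal_nonneg _ _ _)]
  congr 1
  simp only [gaussianPDFReal, gaussRatio, Real.coe_toNNReal _ hv.le, NNReal.coe_one, mul_one,
    sub_zero]
  rw [Real.sqrt_mul (by positivity), mul_inv]
  have : ∀ A B x z : ℝ, A * Real.exp x * (B * Real.exp z) = A * B * Real.exp (x + z) := by
    intro A B x z; rw [Real.exp_add]; ring
  rw [this]
  congr 2
  ring

/-- Adding independent Gaussian noise of variance `κ ^ 2`. -/
lemma lintegral_gaussRatio_add {v : ℝ} (hv : 0 < v) (c κ y : ℝ) :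
    ∫⁻ g, ENNReal.ofReal (gaussRatio v (c + κ * g) y) ∂(gaussianReal 0 1) =
      ENNReal.ofReal (gaussRatio (v + κ ^ 2) c y) := by
  have h : ∀ g, ENNReal.ofReal (gaussRatio v (c + κ * g) y) = ENNReal.ofReal (gaussRatio v c y) *
      ENNReal.ofReal (Real.exp (κ * (y - c) / v * g - κ ^ 2 / v * g ^ 2 / 2)) := by
    intro g
    rw [← ENNReal.ofReal_mul (gaussRatio_nonneg _ _ _), gaussRatio, gaussRatio, mul_assoc,
      ← Real.exp_add]
    congr 3
    field_simp
    ring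
  simp_rw [h]
  have hpos : 0 < 1 + κ ^ 2 / v := by positivity
  rw [lintegral_const_mul _ (by fun_prop), lintegral_exp_quadratic hpos,
    ← ENNReal.ofReal_mul (gaussRatio_nonneg _ _ _)]
  congr 1
  have hs : √(v + κ ^ 2) = √v * √(1 + κ ^ 2 / v) := by
    rw [← Real.sqrt_mul hv.le]; congr 1; field_simp
  have : ∀ A B x z : ℝ, A * Real.exp x * (B * Real.exp z) = A * B * Real.exp (x + z) := by
    intro A B x z; rw [Real.exp_add]; ring
  rw [gaussRatio, gaussRatio, this, hs, mul_inv]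
  congr 2
  field_simp
  ring

/-- A centred Gaussian integral in two variables. -/
lemma lintegral_lintegral_exp_quadratic {a κ : ℝ} (ha : 0 < 1 + a) (h : κ ^ 2 < (1 + a) ^ 2) :
    ∫⁻ g, ∫⁻ y, ENNReal.ofReal (Real.exp (κ * g * y - a * g ^ 2 / 2 - a * y ^ 2 / 2))
      ∂(gaussianReal 0 1) ∂(gaussianReal 0 1) =
      ENNReal.ofReal ((√((1 + a) ^ 2 - κ ^ 2))⁻¹) := by
  have h1 : ∀ g : ℝ, ∫⁻ y, ENNReal.ofReal (Real.exp (κ * g * y - a * g ^ 2 / 2 - a * y ^ 2 / 2))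
      ∂(gaussianReal 0 1) = ENNReal.ofReal ((√(1 + a))⁻¹) *
        ENNReal.ofReal (Real.exp (0 * g - (a - κ ^ 2 / (1 + a)) * g ^ 2 / 2)) := by
    intro g
    have : ∀ y : ℝ, ENNReal.ofReal (Real.exp (κ * g * y - a * g ^ 2 / 2 - a * y ^ 2 / 2)) =
        ENNReal.ofReal (Real.exp (- (a * g ^ 2 / 2))) *
          ENNReal.ofReal (Real.exp (κ * g * y - a * y ^ 2 / 2)) := by
      intro y
      rw [← ENNReal.ofReal_mul (by positivity), ← Real.exp_add]; congr 2; ring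
    simp_rw [this]
    rw [lintegral_const_mul _ (by fun_prop), lintegral_exp_quadratic ha,
      ← ENNReal.ofReal_mul (by positivity), ← ENNReal.ofReal_mul (by positivity), mul_left_comm,
      ← Real.exp_add]
    congr 3
    field_simp
    ring
  simp_rw [h1]
  have h2 : 0 < 1 + (a - κ ^ 2 / (1 + a)) := by
    have : κ ^ 2 / (1 + a) < 1 + a := by rw [div_lt_iff₀ ha]; nlinarith
    linarith
  rw [lintegral_const_mul _ (by fun_prop), lintegral_exp_quadratic h2,
    ← ENNReal.ofReal_mul (by positivity)]
  congr 1
  rw [← mul_assoc, ← mul_inv, ← Real.sqrt_mul ha.le]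
  simp only [ne_eq, OfNat.ofNat_ne_zero, not_false_eq_true, zero_pow, zero_div, Real.exp_zero,
    mul_one]
  congr 2
  field_simp
  ring

/-! ### Product measures and sums of independent Gaussians. -/

lemma lintegral_pi_prod {ι : Type*} [Fintype ι] {Ω : ι → Type*} [∀ i, MeasurableSpace (Ω i)]
    (μ : ∀ i, Measure (Ω i)) [∀ i, IsProbabilityMeasure (μ i)] {f : ∀ i, Ω i → ENNReal}
    (hf : ∀ i, Measurable (f i)) :
    ∫⁻ x, ∏ i, f i (x i) ∂(Measure.pi μ) = ∏ i, ∫⁻ y, f i y ∂(μ i) := by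
  refine (lintegral_prod_eq_prod_lintegral_of_indepFun Finset.univ
    (fun i (x : ∀ i, Ω i) => f i (x i))
    (iIndepFun_pi fun i => (hf i).aemeasurable)
    (fun i => (hf i).comp (measurable_pi_apply i))).trans ?_
  exact Finset.prod_congr rfl fun i _ => (measurePreserving_eval μ i).lintegral_comp (hf i)

lemma pi_withDensity {ι : Type*} [Fintype ι] {Ω : ι → Type*} [∀ i, MeasurableSpace (Ω i)]
    (μ : ∀ i, Measure (Ω i)) [∀ i, IsProbabilityMeasure (μ i)] {f : ∀ i, Ω i → ENNReal}
    (hf : ∀ i, Measurable (f i)) [∀ i, SigmaFinite ((μ i).withDensity (f i))] :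
    Measure.pi (fun i => (μ i).withDensity (f i)) =
      (Measure.pi μ).withDensity fun x => ∏ i, f i (x i) := by
  refine Measure.pi_eq fun s hs => ?_
  rw [withDensity_apply _ (MeasurableSet.univ_pi hs),
    ← lintegral_indicator (MeasurableSet.univ_pi hs)]
  have : ∀ x, (Set.univ.pi s).indicator (fun x => ∏ i, f i (x i)) x =
      ∏ i, (s i).indicator (f i) (x i) := by
    intro x
    by_cases hx : x ∈ Set.univ.pi s
    · rw [Set.indicator_of_mem hx]
      exact Finset.prod_congr rfl fun i _ => (Set.indicator_of_mem (hx i trivial) _).symm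
    · rw [Set.indicator_of_notMem hx]
      simp only [Set.mem_pi, Set.mem_univ, forall_const, not_forall] at hx
      obtain ⟨i, hi⟩ := hx
      exact (Finset.prod_eq_zero (Finset.mem_univ i) (Set.indicator_of_notMem hi _)).symm
  simp_rw [this]
  rw [lintegral_pi_prod μ fun i => (hf i).indicator (hs i)]
  exact Finset.prod_congr rfl fun i _ => by
    rw [lintegral_indicator (hs i), withDensity_apply _ (hs i)]

/-- The pairs `(X i, Y i)` are i.i.d. under the reference law, so moments of products over
observations are `n`-th powers. -/
lemma lintegral_prod_pi_prod {n : ℕ} {α β : Type*} [MeasurableSpace α] [MeasurableSpace β]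
    (μ : Measure α) (ν : Measure β) [IsProbabilityMeasure μ] [IsProbabilityMeasure ν]
    {G : α → β → ENNReal} (hG : Measurable (Function.uncurry G)) :
    ∫⁻ z, ∏ i, G (z.1 i) (z.2 i)
        ∂((Measure.pi fun _ : Fin n => μ).prod (Measure.pi fun _ : Fin n => ν)) =
      (∫⁻ x, ∫⁻ y, G x y ∂ν ∂μ) ^ n := by
  rw [lintegral_prod]
  · have : ∀ x : Fin n → α, ∫⁻ y : Fin n → β, ∏ i, G (x i) (y i) ∂(Measure.pi fun _ => ν) =
        ∏ i, ∫⁻ y, G (x i) y ∂ν := fun x =>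
      lintegral_pi_prod (fun _ : Fin n => ν) fun i => hG.comp measurable_prodMk_left
    simp_rw [this]
    rw [lintegral_pi_prod (fun _ : Fin n => μ) (f := fun _ a => ∫⁻ y, G a y ∂ν)
      fun i => hG.lintegral_prod_right']
    simp
  · refine Measurable.aemeasurable (Finset.measurable_prod _ fun i _ => ?_)
    exact hG.comp (f := fun z : (Fin n → α) × (Fin n → β) => (z.1 i, z.2 i)) (by fun_prop)

lemma map_sum_pi_gaussianReal {ι : Type*} [Fintype ι] (S : Finset ι) :
    (Measure.pi fun _ : ι => gaussianReal 0 1).map (fun x => ∑ j ∈ S, x j) =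
      gaussianReal 0 (S.card : ℝ≥0) := by
  classical
  induction S using Finset.induction_on with
  | empty => simp [Measure.map_const]
  | insert a S ha ih =>
    have hI : iIndepFun (fun (i : ι) (x : ι → ℝ) => x i) (Measure.pi fun _ : ι => gaussianReal 0 1) :=
      iIndepFun_pi (X := fun _ => id) fun _ => aemeasurable_id
    have h1 := (hI.indepFun_finsetSum_of_notMem (fun i => measurable_pi_apply i) ha).symm
    have h2 := gaussianReal_add_gaussianReal_of_indepFun h1
      ((measurePreserving_eval (fun _ : ι => gaussianReal 0 1) a).map_eq)
      (m₂ := 0) (v₂ := S.card) (by rw [← ih]; congr 1; ext x; simp)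
    rw [Finset.card_insert_of_notMem ha]
    convert h2 using 2
    · ext x; simp [Finset.sum_insert ha]
    · simp
    · push_cast; ring

lemma lintegral_gaussianReal_zero (w : ℝ≥0) {f : ℝ → ENNReal} (hf : Measurable f) :
    ∫⁻ x, f x ∂(gaussianReal 0 w) = ∫⁻ g, f (√w * g) ∂(gaussianReal 0 1) := by
  have : gaussianReal 0 w = (gaussianReal 0 1).map (√(w : ℝ) * ·) := by
    rw [gaussianReal_map_const_mul]
    congr 1
    · simp
    · ext; simp
  rw [this, lintegral_map hf (by fun_prop)]

/-- Sums of i.i.d. standard Gaussians over three disjoint sets. -/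
lemma lintegral_disjoint_sums {ι : Type*} [Fintype ι] [DecidableEq ι] {C D E : Finset ι}
    (hCD : Disjoint C D) (hCE : Disjoint C E) (hDE : Disjoint D E)
    {F : ℝ → ℝ → ℝ → ENNReal} (hF : Measurable fun u : ℝ × ℝ × ℝ => F u.1 u.2.1 u.2.2) :
    ∫⁻ x, F (∑ j ∈ C, x j) (∑ j ∈ D, x j) (∑ j ∈ E, x j)
        ∂(Measure.pi fun _ : ι => gaussianReal 0 1) =
      ∫⁻ a, ∫⁻ b, ∫⁻ c, F (√C.card * a) (√D.card * b) (√E.card * c)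
        ∂(gaussianReal 0 1) ∂(gaussianReal 0 1) ∂(gaussianReal 0 1) := by
  set P := Measure.pi fun _ : ι => gaussianReal 0 1
  have hI : iIndepFun (fun (i : ι) (x : ι → ℝ) => x i) P :=
    iIndepFun_pi (X := fun _ => id) fun _ => aemeasurable_id
  have hm : ∀ S : Finset ι, Measurable fun x : ι → ℝ => ∑ j ∈ S, x j := fun S => by fun_prop
  have hs : ∀ S T : Finset ι, Disjoint S T →
      IndepFun (fun x : ι → ℝ => ∑ j ∈ S, x j) (fun x => ∑ j ∈ T, x j) P := by
    intro S T h
    have := (hI.indepFun_finset S T h fun i => measurable_pi_apply i).comp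
      (φ := fun y : S → ℝ => ∑ j, y j) (ψ := fun y : T → ℝ => ∑ j, y j) (by fun_prop) (by fun_prop)
    convert this using 1
    · ext x; exact (Finset.sum_coe_sort S x).symm
    · ext x; exact (Finset.sum_coe_sort T x).symm
  have hC : IndepFun (fun x : ι → ℝ => ∑ j ∈ C, x j)
      (fun x => (∑ j ∈ D, x j, ∑ j ∈ E, x j)) P := by
    have := (hI.indepFun_finset C (D ∪ E) (Finset.disjoint_union_right.2 ⟨hCD, hCE⟩)
      fun i => measurable_pi_apply i).comp (φ := fun y : C → ℝ => ∑ j, y j)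
      (ψ := fun y : (D ∪ E : Finset ι) → ℝ =>
        (∑ j : D, y ⟨j, Finset.mem_union_left _ j.2⟩, ∑ j : E, y ⟨j, Finset.mem_union_right _ j.2⟩))
      (by fun_prop) (by fun_prop)
    convert this using 1
    · ext x; exact (Finset.sum_coe_sort C x).symm
    · ext x
      · exact (Finset.sum_coe_sort D x).symm
      · exact (Finset.sum_coe_sort E x).symm
  have e1 := (indepFun_iff_map_prod_eq_prod_map_map (hm C).aemeasurable
    ((hm D).prodMk (hm E)).aemeasurable).1 hC
  have e2 := (indepFun_iff_map_prod_eq_prod_map_map (hm D).aemeasurable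
    (hm E).aemeasurable).1 (hs D E hDE)
  rw [e2, map_sum_pi_gaussianReal, map_sum_pi_gaussianReal, map_sum_pi_gaussianReal] at e1
  rw [show ∫⁻ x, F (∑ j ∈ C, x j) (∑ j ∈ D, x j) (∑ j ∈ E, x j) ∂P =
    ∫⁻ u, F u.1 u.2.1 u.2.2 ∂(P.map fun x => (∑ j ∈ C, x j, ∑ j ∈ D, x j, ∑ j ∈ E, x j)) from
      (lintegral_map hF ((hm C).prodMk ((hm D).prodMk (hm E)))).symm, e1,
    lintegral_prod _ hF.aemeasurable]
  have hF1 : ∀ a, Measurable fun u : ℝ × ℝ => F a u.1 u.2 := fun a => hF.comp measurable_prodMk_left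
  have hF2 : ∀ a b, Measurable fun c : ℝ => F a b c := fun a b => (hF1 a).comp measurable_prodMk_left
  simp_rw [fun a => lintegral_prod _ (hF1 a).aemeasurable
    (μ := gaussianReal 0 (D.card : ℝ≥0)) (ν := gaussianReal 0 (E.card : ℝ≥0))]
  rw [lintegral_gaussianReal_zero _
    (Measurable.lintegral_prod_right' (f := fun u : ℝ × ℝ => ∫⁻ c, F u.1 u.2 c ∂(gaussianReal 0 _))
      (Measurable.lintegral_prod_right' (f := fun u : (ℝ × ℝ) × ℝ => F u.1.1 u.1.2 u.2)
        (hF.comp (f := fun u : (ℝ × ℝ) × ℝ => (u.1.1, u.1.2, u.2)) (by fun_prop))))]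
  refine lintegral_congr fun a => ?_
  rw [lintegral_gaussianReal_zero _
    (Measurable.lintegral_prod_right' (f := fun u : ℝ × ℝ => F _ u.1 u.2) (hF1 _))]
  refine lintegral_congr fun b => ?_
  rw [lintegral_gaussianReal_zero _ (hF2 _ _)]
  simp

/-! ### The reference law and the likelihood ratios. -/

/-- The law of the observations when `θ = 0` and `σ = 1`. -/
noncomputable def refLaw (n p : ℕ) : Measure (Obs n p) :=
  (designLaw n p).prod (Measure.pi fun _ => gaussianReal 0 1)

/-- The vector equal to `h` on `S` and to zero elsewhere. -/
noncomputable def spike {p : ℕ} (h : ℝ) (S : Finset (Fin p)) : EuclideanSpace ℝ (Fin p) :=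
  WithLp.toLp 2 fun j => if j ∈ S then h else 0

/-- The likelihood ratio of `P_{θ,σ}` with respect to `P_{0,1}` for `θ = spike h S`, `σ ^ 2 = v`. -/
noncomputable def likRatio {n p : ℕ} (v h : ℝ) (S : Finset (Fin p)) (z : Obs n p) : ℝ :=
  ∏ i, gaussRatio v (h * ∑ j ∈ S, z.1 i j) (z.2 i)

instance (n p : ℕ) : IsProbabilityMeasure (designLaw n p) := by
  unfold designLaw; infer_instance

instance (n : ℕ) (σ : ℝ) : IsProbabilityMeasure (noiseLaw n σ) := by
  unfold noiseLaw; infer_instance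

instance (n p : ℕ) : IsProbabilityMeasure (refLaw n p) := by
  unfold refLaw; infer_instance

lemma measurable_response {n p : ℕ} (θ : EuclideanSpace ℝ (Fin p)) :
    Measurable fun w : Obs n p => ((w.1, fun i => (∑ j, θ j * w.1 i j) + w.2 i) : Obs n p) := by
  fun_prop

instance (n p : ℕ) (θ : EuclideanSpace ℝ (Fin p)) (σ : ℝ) :
    IsProbabilityMeasure (obsLaw n p θ σ) := by
  unfold obsLaw
  exact Measure.isProbabilityMeasure_map (measurable_response θ).aemeasurable

lemma likRatio_nonneg {n p : ℕ} (v h : ℝ) (S : Finset (Fin p)) (z : Obs n p) :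
    0 ≤ likRatio v h S z :=
  Finset.prod_nonneg fun _ _ => gaussRatio_nonneg _ _ _

@[fun_prop]
lemma measurable_likRatio {n p : ℕ} (v h : ℝ) (S : Finset (Fin p)) :
    Measurable (likRatio v h S : Obs n p → ℝ) := by
  unfold likRatio; fun_prop

lemma obsLaw_zero_one (n p : ℕ) : obsLaw n p 0 1 = refLaw n p := by
  simp [obsLaw, refLaw, noiseLaw]

lemma sum_spike_mul {p : ℕ} (h : ℝ) (S : Finset (Fin p)) (x : Fin p → ℝ) :
    ∑ j, spike h S j * x j = h * ∑ j ∈ S, x j := by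
  simp [spike, Finset.mul_sum]

/-- Given the design, the responses are independent Gaussians with means `h * ∑ j ∈ S, X i j`. The
design has the same law on both sides, so the conditional density is the full one. -/
lemma obsLaw_spike {n p : ℕ} (h : ℝ) (S : Finset (Fin p)) {σ : ℝ} (hσ : 0 < σ) :
    obsLaw n p (spike h S) σ =
      (refLaw n p).withDensity fun z => ENNReal.ofReal (likRatio (σ ^ 2) h S z) := by
  refine Measure.ext_of_lintegral _ fun f hf => ?_
  have hL : Measurable fun z : Obs n p => ENNReal.ofReal (likRatio (σ ^ 2) h S z) := by fun_prop
  have hg : Measurable fun w : Obs n p =>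
      f (w.1, fun i => (∑ j, spike h S j * w.1 i j) + w.2 i) := hf.comp (measurable_response _)
  rw [obsLaw, lintegral_map hf (measurable_response _), lintegral_prod _ hg.aemeasurable,
    lintegral_withDensity_eq_lintegral_mul _ hL hf, refLaw, lintegral_prod _ (hL.mul hf).aemeasurable]
  refine lintegral_congr fun x => ?_
  set m : Fin n → ℝ := fun i => h * ∑ j ∈ S, x i j
  have h1 : (noiseLaw n σ).map (fun ξ i => m i + ξ i) =
      (Measure.pi fun _ : Fin n => gaussianReal 0 1).withDensity fun y =>
        ∏ i, ENNReal.ofReal (gaussRatio (σ ^ 2) (m i) (y i)) := by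
    rw [noiseLaw, Measure.pi_map_pi (f := fun i t => m i + t) (fun i => by fun_prop)]
    have h2 : ∀ i, (gaussianReal 0 (σ ^ 2).toNNReal).map (fun t => m i + t) =
        (gaussianReal 0 1).withDensity fun y => ENNReal.ofReal (gaussRatio (σ ^ 2) (m i) y) := by
      intro i
      rw [gaussianReal_map_const_add, zero_add, gaussianReal_eq_withDensity (by positivity)]
    have : ∀ i, SigmaFinite ((gaussianReal 0 1).withDensity
        fun y => ENNReal.ofReal (gaussRatio (σ ^ 2) (m i) y)) := by
      intro i
      rw [← gaussianReal_eq_withDensity (by positivity)]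
      infer_instance
    simp_rw [h2]
    rw [pi_withDensity _ fun i => by fun_prop]
  have h3 : Measurable fun y : Fin n → ℝ => f (x, y) := hf.comp measurable_prodMk_left
  calc ∫⁻ ξ, f (x, fun i => (∑ j, spike h S j * x i j) + ξ i) ∂(noiseLaw n σ)
      = ∫⁻ ξ, f (x, fun i => m i + ξ i) ∂(noiseLaw n σ) := by simp_rw [sum_spike_mul, m]
    _ = ∫⁻ y, f (x, y) ∂((noiseLaw n σ).map (fun ξ i => m i + ξ i)) :=
        (lintegral_map h3 (by fun_prop)).symm
    _ = _ := by
        rw [h1, lintegral_withDensity_eq_lintegral_mul _ (by fun_prop) h3]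
        refine lintegral_congr fun y => ?_
        simp only [Pi.mul_apply, likRatio, m]
        rw [ENNReal.ofReal_prod_of_nonneg fun _ _ => gaussRatio_nonneg _ _ _]

/-! ### Moments of the likelihood ratios for a single observation. -/

/-- The row enters only through its sums over `S ∩ S'`, `S \ S'` and `S' \ S`, which are independent
Gaussians. Integrating out the last two leaves a Gaussian integral in the shared sum and `y`. The
tilt `μ` serves the truncated second moment; `μ = 0` gives the plain one. -/
lemma lintegral_gaussRatio_mul_gaussRatio {ι : Type*} [Fintype ι] [DecidableEq ι] {S S' : Finset ι}
    {m : ℕ} (hS : S.card = m) (hS' : S'.card = m) {h v μ : ℝ} (hv : 0 < v)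
    (hvm : v = 1 - m * h ^ 2)
    (hpos : 0 < 1 - μ ^ 2 * (S ∩ S').card +
      4 * h * μ * (S ∩ S').card / (1 - h ^ 2 * (S ∩ S').card)) :
    ∫⁻ x, ∫⁻ y, ENNReal.ofReal (gaussRatio v (h * ∑ j ∈ S, x j) y) *
        ENNReal.ofReal (gaussRatio v (h * ∑ j ∈ S', x j) y) *
        ENNReal.ofReal (Real.exp (-(μ * y * ∑ j ∈ S ∩ S', x j)))
        ∂(gaussianReal 0 1) ∂(Measure.pi fun _ : ι => gaussianReal 0 1) =
      ENNReal.ofReal ((1 - h ^ 2 * (S ∩ S').card)⁻¹ * (√(1 - μ ^ 2 * (S ∩ S').card +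
        4 * h * μ * (S ∩ S').card / (1 - h ^ 2 * (S ∩ S').card)))⁻¹) := by
  set C := S ∩ S'
  have hT : C.card ≤ m := hS ▸ Finset.card_le_card Finset.inter_subset_left
  have cS : C.card + (S \ S').card = m := by rw [← hS, Finset.card_inter_add_card_sdiff]
  have cS' : C.card + (S' \ S).card = m := by
    rw [← hS', ← Finset.card_inter_add_card_sdiff S' S, Finset.inter_comm S' S]
  have sS : ∀ x : ι → ℝ, ∑ j ∈ S, x j = ∑ j ∈ C, x j + ∑ j ∈ S \ S', x j := fun x =>
    (Finset.sum_inter_add_sum_sdiff S S' x).symm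
  have sS' : ∀ x : ι → ℝ, ∑ j ∈ S', x j = ∑ j ∈ C, x j + ∑ j ∈ S' \ S, x j := fun x => by
    rw [← Finset.sum_inter_add_sum_sdiff S' S x, Finset.inter_comm S' S]
  set T : ℝ := (C.card : ℝ)
  have hT0 : 0 ≤ T := Nat.cast_nonneg _
  have rS : ((S \ S').card : ℝ) = m - T := by
    rw [← cS]; push_cast; ring
  have rS' : ((S' \ S).card : ℝ) = m - T := by
    rw [← cS']; push_cast; ring
  have hmT : 0 ≤ (m : ℝ) - T := by rw [← rS]; positivity
  have ht : 0 < 1 - h ^ 2 * T := by nlinarith [sq_nonneg h]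
  have d1 : Disjoint C (S \ S') := Finset.disjoint_left.2 fun a ha hb =>
    (Finset.mem_sdiff.1 hb).2 (Finset.mem_inter.1 ha).2
  have d2 : Disjoint C (S' \ S) := Finset.disjoint_left.2 fun a ha hb =>
    (Finset.mem_sdiff.1 hb).2 (Finset.mem_inter.1 ha).1
  have d3 : Disjoint (S \ S') (S' \ S) := Finset.disjoint_left.2 fun a ha hb =>
    (Finset.mem_sdiff.1 hb).2 (Finset.mem_sdiff.1 ha).1
  rw [lintegral_lintegral_swap (by fun_prop)]
  have step : ∀ y, ∫⁻ x, ENNReal.ofReal (gaussRatio v (h * ∑ j ∈ S, x j) y) *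
      ENNReal.ofReal (gaussRatio v (h * ∑ j ∈ S', x j) y) *
      ENNReal.ofReal (Real.exp (-(μ * y * ∑ j ∈ C, x j)))
        ∂(Measure.pi fun _ : ι => gaussianReal 0 1) =
      ∫⁻ a, ENNReal.ofReal ((1 - h ^ 2 * T)⁻¹) * ENNReal.ofReal (Real.exp
        ((2 * h * √T / (1 - h ^ 2 * T) - μ * √T) * y * a - 2 * h ^ 2 * T / (1 - h ^ 2 * T) * y ^ 2 / 2
          - 2 * h ^ 2 * T / (1 - h ^ 2 * T) * a ^ 2 / 2)) ∂(gaussianReal 0 1) := by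
    intro y
    simp_rw [sS, sS']
    rw [lintegral_disjoint_sums d1 d2 d3 (F := fun a b c => ENNReal.ofReal (gaussRatio v
      (h * (a + b)) y) * ENNReal.ofReal (gaussRatio v (h * (a + c)) y) *
      ENNReal.ofReal (Real.exp (-(μ * y * a)))) (by fun_prop)]
    refine lintegral_congr fun a => ?_
    rw [rS, rS', show (C.card : ℝ) = T from rfl]
    -- The unshared coordinates act as extra noise: the variance becomes `v + h ^ 2 * (m - T)`,
    -- which is `1 - h ^ 2 * T` by the choice of `v`.
    have key : ∫⁻ b, ENNReal.ofReal (gaussRatio v (h * (√T * a + √(m - T) * b)) y)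
        ∂(gaussianReal 0 1) = ENNReal.ofReal (gaussRatio (1 - h ^ 2 * T) (h * √T * a) y) := by
      have e : ∀ b, h * (√T * a + √(m - T) * b) = h * √T * a + (h * √(m - T)) * b := by
        intro b; ring
      simp_rw [e]
      rw [lintegral_gaussRatio_add hv]
      congr 2
      rw [mul_pow, Real.sq_sqrt hmT, hvm]; ring
    simp_rw [fun b c => mul_assoc (ENNReal.ofReal (gaussRatio v (h * (√T * a + √(m - T) * b)) y))
      (ENNReal.ofReal (gaussRatio v (h * (√T * a + √(m - T) * c)) y))]
    simp_rw [fun b => lintegral_const_mul (μ := gaussianReal 0 1)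
      (ENNReal.ofReal (gaussRatio v (h * (√T * a + √(m - T) * b)) y))
      (f := fun c => ENNReal.ofReal (gaussRatio v (h * (√T * a + √(m - T) * c)) y) *
        ENNReal.ofReal (Real.exp (-(μ * y * (√T * a))))) (by fun_prop)]
    rw [lintegral_mul_const _ (by fun_prop), lintegral_mul_const _ (by fun_prop), key,
      ← ENNReal.ofReal_mul (gaussRatio_nonneg _ _ _),
      ← ENNReal.ofReal_mul (gaussRatio_nonneg _ _ _), ← ENNReal.ofReal_mul (by positivity)]
    congr 1
    have : ∀ A x z w : ℝ, A⁻¹ * Real.exp x * (A⁻¹ * Real.exp z * Real.exp w) =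
        (A ^ 2)⁻¹ * Real.exp (x + z + w) := by
      intro A x z w; rw [Real.exp_add, Real.exp_add, sq, mul_inv]; ring
    rw [gaussRatio, this, Real.sq_sqrt ht.le]
    congr 2
    have hq : T = √T ^ 2 := (Real.sq_sqrt hT0).symm
    generalize √T = q at *
    rw [hq] at ht ⊢
    field_simp
    ring
  simp_rw [step]
  have c1 : 1 + 2 * h ^ 2 * T / (1 - h ^ 2 * T) = (1 + h ^ 2 * T) / (1 - h ^ 2 * T) := by
    field_simp; ring
  have hdet : (1 + 2 * h ^ 2 * T / (1 - h ^ 2 * T)) ^ 2 -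
      (2 * h * √T / (1 - h ^ 2 * T) - μ * √T) ^ 2 =
      1 - μ ^ 2 * T + 4 * h * μ * T / (1 - h ^ 2 * T) := by
    have hq : T = √T ^ 2 := (Real.sq_sqrt hT0).symm
    generalize √T = q at *
    rw [hq] at ht ⊢
    field_simp
    ring
  simp_rw [fun y : ℝ => lintegral_const_mul (μ := gaussianReal 0 1)
    (ENNReal.ofReal ((1 - h ^ 2 * T)⁻¹)) (f := fun a => ENNReal.ofReal (Real.exp
        ((2 * h * √T / (1 - h ^ 2 * T) - μ * √T) * y * a - 2 * h ^ 2 * T / (1 - h ^ 2 * T) * y ^ 2 / 2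
          - 2 * h ^ 2 * T / (1 - h ^ 2 * T) * a ^ 2 / 2))) (by fun_prop)]
  rw [lintegral_const_mul' _ _ ENNReal.ofReal_ne_top, lintegral_lintegral_exp_quadratic
    (by rw [c1]; positivity) (by linarith), hdet, ← ENNReal.ofReal_mul (inv_nonneg.2 ht.le)]

/-- This is the moment generating function of `X j * Y` under the alternative, for `j` in the
support. The other `m - 1` coordinates of `S` are absorbed into the noise, whose variance becomes `1
- h ^ 2`. -/
lemma lintegral_gaussRatio_mul_exp {ι : Type*} [Fintype ι] [DecidableEq ι] {S : Finset ι}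
    {m : ℕ} (hS : S.card = m) {h v μ : ℝ} (hv : 0 < v) (hvm : v = 1 - m * h ^ 2) {j : ι}
    (hj : j ∈ S) (hpos : 0 < 1 - 2 * h * μ - μ ^ 2 * (1 - h ^ 2)) :
    ∫⁻ x, ∫⁻ y, ENNReal.ofReal (gaussRatio v (h * ∑ j ∈ S, x j) y) *
        ENNReal.ofReal (Real.exp (μ * y * x j))
        ∂(gaussianReal 0 1) ∂(Measure.pi fun _ : ι => gaussianReal 0 1) =
      ENNReal.ofReal ((√(1 - 2 * h * μ - μ ^ 2 * (1 - h ^ 2)))⁻¹) := by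
  have hm1 : (1 : ℝ) ≤ m := by
    rw [← hS]; exact_mod_cast Finset.card_pos.2 ⟨j, hj⟩
  have ht : 0 < 1 - h ^ 2 := by nlinarith [sq_nonneg h]
  have rS : ((S.erase j).card : ℝ) = m - 1 := by
    rw [← hS, Finset.cast_card_erase_of_mem hj]
  rw [lintegral_lintegral_swap (by fun_prop)]
  have step : ∀ y, ∫⁻ x, ENNReal.ofReal (gaussRatio v (h * ∑ j ∈ S, x j) y) *
      ENNReal.ofReal (Real.exp (μ * y * x j)) ∂(Measure.pi fun _ : ι => gaussianReal 0 1) =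
      ∫⁻ a, ENNReal.ofReal ((√(1 - h ^ 2))⁻¹) * ENNReal.ofReal (Real.exp
        ((h / (1 - h ^ 2) + μ) * y * a - h ^ 2 / (1 - h ^ 2) * y ^ 2 / 2
          - h ^ 2 / (1 - h ^ 2) * a ^ 2 / 2)) ∂(gaussianReal 0 1) := by
    intro y
    have sS : ∀ x : ι → ℝ, ∑ j ∈ S, x j = ∑ i ∈ {j}, x i + ∑ i ∈ S.erase j, x i := fun x => by
      rw [Finset.sum_singleton, Finset.add_sum_erase _ _ hj]
    have sj : ∀ x : ι → ℝ, x j = ∑ i ∈ {j}, x i := fun x => by simp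
    simp_rw [sS, fun x : ι → ℝ => congrArg (fun t => ENNReal.ofReal (Real.exp (μ * y * t))) (sj x)]
    rw [lintegral_disjoint_sums (C := {j}) (D := S.erase j) (E := ∅) (by simp) (by simp) (by simp)
      (F := fun a b c => ENNReal.ofReal (gaussRatio v (h * (a + b)) y) *
      ENNReal.ofReal (Real.exp (μ * y * a))) (by fun_prop)]
    refine lintegral_congr fun a => ?_
    simp only [lintegral_const, measure_univ, mul_one, rS, Finset.card_singleton, Nat.cast_one,
      Real.sqrt_one, one_mul]
    have e : ∀ b, h * (a + √(m - 1) * b) = h * a + (h * √(m - 1)) * b := by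
      intro b; ring
    simp_rw [e]
    rw [lintegral_mul_const _ (by fun_prop), lintegral_gaussRatio_add hv, mul_pow,
      Real.sq_sqrt (by linarith), show v + h ^ 2 * (m - 1) = 1 - h ^ 2 by rw [hvm]; ring,
      ← ENNReal.ofReal_mul (gaussRatio_nonneg _ _ _), ← ENNReal.ofReal_mul (by positivity),
      gaussRatio, mul_assoc, ← Real.exp_add]
    congr 3
    field_simp
    ring
  simp_rw [step]
  have c1 : 1 + h ^ 2 / (1 - h ^ 2) = 1 / (1 - h ^ 2) := by
    field_simp; ring
  have hdet : (1 + h ^ 2 / (1 - h ^ 2)) ^ 2 - (h / (1 - h ^ 2) + μ) ^ 2 =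
      (1 - 2 * h * μ - μ ^ 2 * (1 - h ^ 2)) / (1 - h ^ 2) := by
    field_simp
    ring
  have hdet' : 0 < (1 - 2 * h * μ - μ ^ 2 * (1 - h ^ 2)) / (1 - h ^ 2) := by positivity
  simp_rw [fun y : ℝ => lintegral_const_mul (μ := gaussianReal 0 1)
    (ENNReal.ofReal ((√(1 - h ^ 2))⁻¹)) (f := fun a => ENNReal.ofReal (Real.exp
        ((h / (1 - h ^ 2) + μ) * y * a - h ^ 2 / (1 - h ^ 2) * y ^ 2 / 2
          - h ^ 2 / (1 - h ^ 2) * a ^ 2 / 2))) (by fun_prop)]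
  rw [lintegral_const_mul' _ _ ENNReal.ofReal_ne_top, lintegral_lintegral_exp_quadratic
    (by rw [c1]; positivity) (by linarith), hdet, ← ENNReal.ofReal_mul (by positivity),
    Real.sqrt_div hpos.le]
  congr 1
  have := Real.sqrt_pos.2 ht
  field_simp

/-! ### The second moment method for testing. -/

/-- Nonnegativity of the variance of `|X|`. -/
lemma integral_abs_le_sqrt {Ω : Type*} [MeasurableSpace Ω] {μ : Measure Ω} [IsProbabilityMeasure μ]
    {X : Ω → ℝ} (hX : Integrable X μ) (hX2 : Integrable (fun ω => X ω ^ 2) μ) :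
    ∫ ω, |X ω| ∂μ ≤ √(∫ ω, X ω ^ 2 ∂μ) := by
  apply Real.le_sqrt_of_sq_le
  set c := ∫ ω, |X ω| ∂μ with hc
  have h0 : 0 ≤ ∫ ω, (|X ω| - c) ^ 2 ∂μ := integral_nonneg fun ω => sq_nonneg _
  have h1 : ∀ ω, (|X ω| - c) ^ 2 = X ω ^ 2 - 2 * c * |X ω| + c ^ 2 := fun ω => by
    rw [sub_sq, sq_abs]; ring
  simp_rw [h1] at h0
  have hi : Integrable (fun ω => X ω ^ 2 - 2 * c * |X ω|) μ := hX2.sub (hX.abs.const_mul _)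
  rw [integral_add hi (integrable_const _),
    integral_sub hX2 (hX.abs.const_mul _), integral_const_mul, ← hc] at h0
  simp at h0
  nlinarith

/-- Lower bound for the sum of the error probabilities of a test of `μ` against the uniform mixture
of the `ν i`, by the second moment of the truncated likelihood ratio. -/
lemma one_sub_sqrt_le_error {Ω ι : Type*} [MeasurableSpace Ω] [Fintype ι] [Nonempty ι]
    {μ : Measure Ω} [IsProbabilityMeasure μ] {ν : ι → Measure Ω} [∀ i, IsProbabilityMeasure (ν i)]
    {L : ι → Ω → ℝ} (hLm : ∀ i, Measurable (L i)) (hL0 : ∀ i ω, 0 ≤ L i ω)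
    (hν : ∀ i, ν i = μ.withDensity fun ω => ENNReal.ofReal (L i ω))
    {A : ι → Set Ω} (hAm : ∀ i, MeasurableSet (A i)) {δ₁ δ₂ : ℝ} (hδ₁ : 0 ≤ δ₁) (hδ₂ : 0 ≤ δ₂)
    (hA : ∀ i, ν i (A i)ᶜ ≤ ENNReal.ofReal δ₁)
    (h2 : ∀ i, ∑ j, ∫⁻ ω, (A i).indicator (fun ω => ENNReal.ofReal (L i ω)) ω *
      (A j).indicator (fun ω => ENNReal.ofReal (L j ω)) ω ∂μ ≤
        ENNReal.ofReal (Fintype.card ι * (1 + δ₂)))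
    {ψ : Ω → ℝ} (hψm : Measurable ψ) (hψ : ∀ ω, ψ ω ∈ Set.Icc (0 : ℝ) 1) :
    1 - √(2 * δ₁ + δ₂) ≤
      ∫ ω, ψ ω ∂μ + (Fintype.card ι : ℝ)⁻¹ * ∑ i, ∫ ω, (1 - ψ ω) ∂(ν i) := by
  set N : ℝ := (Fintype.card ι : ℝ)
  have hN : 0 < N := Nat.cast_pos.2 Fintype.card_pos
  have hLi : ∀ i, Integrable (L i) μ := fun i => by
    refine ⟨(hLm i).aestronglyMeasurable, ?_⟩
    rw [hasFiniteIntegral_iff_ofReal (ae_of_all _ (hL0 i)), ← setLIntegral_univ,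
      ← withDensity_apply _ MeasurableSet.univ, ← hν i]
    simp
  set f : ι → Ω → ℝ := fun i => (A i).indicator (L i)
  have hf0 : ∀ i ω, 0 ≤ f i ω := fun i ω => Set.indicator_nonneg (fun ω _ => hL0 i ω) ω
  have hfL : ∀ i ω, f i ω ≤ L i ω := fun i ω => Set.indicator_le_self' (fun ω _ => hL0 i ω) ω
  have hfm : ∀ i, Measurable (f i) := fun i => (hLm i).indicator (hAm i)
  have hfi : ∀ i, Integrable (f i) μ := fun i => (hLi i).indicator (hAm i)
  have hof : ∀ i ω, (A i).indicator (fun ω => ENNReal.ofReal (L i ω)) ω = ENNReal.ofReal (f i ω) := by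
    intro i ω
    by_cases h : ω ∈ A i <;> simp [f, h]
  simp_rw [hof, ← ENNReal.ofReal_mul (hf0 _ _)] at h2
  -- Each product is dominated in integral by the finite sum in `h2`, which makes the Bochner
  -- integrals below meaningful.
  have hffi : ∀ i j, Integrable (fun ω => f i ω * f j ω) μ := fun i j => by
    refine ⟨((hfm i).mul (hfm j)).aestronglyMeasurable, ?_⟩
    rw [hasFiniteIntegral_iff_ofReal (ae_of_all _ fun ω => mul_nonneg (hf0 i ω) (hf0 j ω))]
    exact lt_of_le_of_lt ((Finset.single_le_sum (f := fun j =>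
      ∫⁻ ω, ENNReal.ofReal (f i ω * f j ω) ∂μ) (fun _ _ => zero_le) (Finset.mem_univ j)).trans (h2 i))
        ENNReal.ofReal_lt_top
  have hff : ∀ i, ∑ j, ∫ ω, f i ω * f j ω ∂μ ≤ N * (1 + δ₂) := by
    intro i
    have h0 : ∀ j, 0 ≤ ∫ ω, f i ω * f j ω ∂μ := fun j =>
      integral_nonneg fun ω => mul_nonneg (hf0 i ω) (hf0 j ω)
    rw [← ENNReal.ofReal_le_ofReal_iff (by positivity),
      ENNReal.ofReal_sum_of_nonneg fun j _ => h0 j]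
    refine le_of_eq_of_le (Finset.sum_congr rfl fun j _ => ?_) (h2 i)
    exact ofReal_integral_eq_lintegral_ofReal (hffi i j)
      (ae_of_all _ fun ω => mul_nonneg (hf0 i ω) (hf0 j ω))
  have hf1 : ∀ i, 1 - δ₁ ≤ ∫ ω, f i ω ∂μ := by
    intro i
    have e : ENNReal.ofReal (∫ ω, f i ω ∂μ) = ν i (A i) := by
      rw [ofReal_integral_eq_lintegral_ofReal (hfi i) (ae_of_all _ (hf0 i)), hν i,
        withDensity_apply _ (hAm i), ← lintegral_indicator (hAm i)]
      exact lintegral_congr fun ω => (hof i ω).symm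
    have e2 : ∫ ω, f i ω ∂μ = (ν i).real (A i) := by
      rw [measureReal_def, ← e, ENNReal.toReal_ofReal (integral_nonneg (hf0 i))]
    have e3 : (ν i).real (A i)ᶜ ≤ δ₁ := ENNReal.toReal_le_of_le_ofReal hδ₁ (hA i)
    rw [probReal_compl_eq_one_sub (hAm i)] at e3
    linarith
  set g : Ω → ℝ := fun ω => N⁻¹ * ∑ i, f i ω
  have hgi : Integrable g μ := (integrable_finsetSum _ fun i _ => hfi i).const_mul _
  have hg2 : ∀ ω, g ω ^ 2 = N⁻¹ ^ 2 * ∑ i, ∑ j, f i ω * f j ω := fun ω => by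
    simp only [g]; rw [mul_pow, sq (∑ i, f i ω), Finset.sum_mul_sum]
  have hg2i : Integrable (fun ω => g ω ^ 2) μ := by
    simp_rw [hg2]
    exact (integrable_finsetSum _ fun i _ => integrable_finsetSum _ fun j _ => hffi i j).const_mul _
  have Ig : 1 - δ₁ ≤ ∫ ω, g ω ∂μ := by
    simp only [g]
    rw [integral_const_mul, integral_finsetSum _ fun i _ => hfi i]
    calc 1 - δ₁ = N⁻¹ * ∑ i : ι, (1 - δ₁) := by
          rw [Finset.sum_const, Finset.card_univ, nsmul_eq_mul,
            show (Fintype.card ι : ℝ) = N from rfl]; field_simp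
      _ ≤ _ := by gcongr with i _; exact hf1 i
  have Ig2 : ∫ ω, g ω ^ 2 ∂μ ≤ 1 + δ₂ := by
    simp_rw [hg2]
    rw [integral_const_mul, integral_finsetSum _ fun i _ => integrable_finsetSum _ fun j _ => hffi i j]
    simp_rw [fun i => integral_finsetSum (μ := μ) Finset.univ fun j _ => hffi i j]
    calc N⁻¹ ^ 2 * ∑ i, ∑ j, ∫ ω, f i ω * f j ω ∂μ ≤ N⁻¹ ^ 2 * ∑ i : ι, N * (1 + δ₂) := by
          gcongr with i _; exact hff i
      _ = 1 + δ₂ := by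
          rw [Finset.sum_const, Finset.card_univ, nsmul_eq_mul,
            show (Fintype.card ι : ℝ) = N from rfl]; field_simp
  have hXi : Integrable (fun ω => 1 - g ω) μ := (integrable_const _).sub hgi
  have e1 : ∀ ω, (1 - g ω) ^ 2 = 1 - 2 * g ω + g ω ^ 2 := fun ω => by ring
  have hXi2 : Integrable (fun ω => (1 - g ω) ^ 2) μ := by
    simp_rw [e1]
    exact ((integrable_const _).sub (hgi.const_mul _)).add hg2i
  -- The bound is `1 - 2 * (1 - δ₁) + (1 + δ₂)`: truncation costs mass `δ₁` only in the linear term.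
  have IX : ∫ ω, (1 - g ω) ^ 2 ∂μ ≤ 2 * δ₁ + δ₂ := by
    have hi : Integrable (fun ω => 1 - 2 * g ω) μ := (integrable_const _).sub (hgi.const_mul _)
    simp_rw [e1]
    rw [integral_add hi hg2i,
      integral_sub (integrable_const _) (hgi.const_mul _), integral_const_mul]
    simp
    linarith
  have hψi : Integrable ψ μ := Integrable.of_bound hψm.aestronglyMeasurable 1 (ae_of_all _ fun ω => by
    rw [Real.norm_eq_abs, abs_le]; constructor <;> linarith [(hψ ω).1, (hψ ω).2])
  have hbd : ∀ᵐ ω ∂μ, ‖1 - ψ ω‖ ≤ 1 := ae_of_all _ fun ω => by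
    rw [Real.norm_eq_abs, abs_le]; constructor <;> linarith [(hψ ω).1, (hψ ω).2]
  have hψm' : AEStronglyMeasurable (fun ω => 1 - ψ ω) μ :=
    (measurable_const.sub hψm).aestronglyMeasurable
  have hν1 : ∀ i, ∫ ω, f i ω * (1 - ψ ω) ∂μ ≤ ∫ ω, (1 - ψ ω) ∂(ν i) := by
    intro i
    rw [hν i, integral_withDensity_eq_integral_toReal_smul (by fun_prop)
      (ae_of_all _ fun ω => ENNReal.ofReal_lt_top)]
    refine integral_mono ((hfi i).mul_bdd hψm' hbd) ?_ fun ω => ?_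
    · simp_rw [ENNReal.toReal_ofReal (hL0 _ _), smul_eq_mul]
      exact (hLi i).mul_bdd hψm' hbd
    · simp only [ENNReal.toReal_ofReal (hL0 _ _), smul_eq_mul]
      exact mul_le_mul_of_nonneg_right (hfL i ω) (by linarith [(hψ ω).2])
  have hgψ : ∫ ω, g ω * (1 - ψ ω) ∂μ ≤ N⁻¹ * ∑ i, ∫ ω, (1 - ψ ω) ∂(ν i) := by
    simp only [g, mul_assoc, Finset.sum_mul]
    rw [integral_const_mul, integral_finsetSum _ fun i _ => (hfi i).mul_bdd hψm' hbd]
    gcongr with i _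
    exact hν1 i
  -- Pointwise, `ψ + g * (1 - ψ) = 1 - (1 - g) * (1 - ψ)` with `0 ≤ 1 - ψ ≤ 1`.
  have hfin : ∫ ω, (1 - |1 - g ω|) ∂μ ≤ ∫ ω, (ψ ω + g ω * (1 - ψ ω)) ∂μ := by
    refine integral_mono ((integrable_const _).sub hXi.abs) (hψi.add (hgi.mul_bdd hψm' hbd))
      fun ω => ?_
    have h1 := (hψ ω).1
    have h2 := (hψ ω).2
    have h3 := le_abs_self (1 - g ω)
    have h4 := abs_nonneg (1 - g ω)
    simp only
    nlinarith [mul_le_mul_of_nonneg_left h3 (sub_nonneg.2 h2), mul_nonneg h1 h4]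
  rw [integral_add hψi (hgi.mul_bdd hψm' hbd), integral_sub (integrable_const _) hXi.abs] at hfin
  simp at hfin
  have := integral_abs_le_sqrt hXi hXi2
  have := Real.sqrt_le_sqrt IX
  linarith

lemma integral_mem_Icc {Ω : Type*} [MeasurableSpace Ω] {μ : Measure Ω} [IsProbabilityMeasure μ]
    {ψ : Ω → ℝ} (hψ : ∀ ω, ψ ω ∈ Set.Icc (0 : ℝ) 1) : ∫ ω, ψ ω ∂μ ∈ Set.Icc (0 : ℝ) 1 := by
  refine ⟨integral_nonneg fun ω => (hψ ω).1, ?_⟩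
  calc ∫ ω, ψ ω ∂μ ≤ ∫ _, (1 : ℝ) ∂μ :=
        integral_mono_of_nonneg (ae_of_all _ fun ω => (hψ ω).1) (integrable_const _)
          (ae_of_all _ fun ω => (hψ ω).2)
    _ = 1 := by simp

lemma one_sub_mem_Icc {Ω : Type*} {ψ : Ω → ℝ} (hψ : ∀ ω, ψ ω ∈ Set.Icc (0 : ℝ) 1) :
    ∀ ω, 1 - ψ ω ∈ Set.Icc (0 : ℝ) 1 :=
  fun ω => ⟨by linarith [(hψ ω).2], by linarith [(hψ ω).1]⟩

lemma minimaxError_le_one (n p : ℕ) (k r : ℝ) : minimaxError n p k r ≤ 1 := by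
  have h0 : (fun _ => 0 : Obs n p → ℝ) ∈ tests n p := ⟨measurable_const, fun _ => by simp⟩
  refine (ciInf_le ⟨0, ?_⟩ (⟨_, h0⟩ : tests n p)).trans ?_
  · rintro _ ⟨ψ, rfl⟩
    exact add_nonneg (Real.iSup_nonneg fun σ => integral_nonneg fun z => (ψ.2.2 z).1)
      (Real.iSup_nonneg fun q => integral_nonneg fun z => (one_sub_mem_Icc ψ.2.2 z).1)
  · simp only [typeIError, typeIIError, integral_zero, sub_zero, integral_const,
      probReal_univ, smul_eq_mul, mul_one, Real.iSup_const_zero, zero_add]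
    -- An inequality, since the set of alternatives may be empty and its supremum is then zero.
    exact Real.iSup_le (fun _ => le_rfl) zero_le_one

/-- Suprema dominate the null at `σ = 1` and any average of alternatives. The factor `σ⁻¹` appears
because the alternatives are parametrised as `σ • θ`. -/
lemma le_minimaxError {n p : ℕ} {k r : ℝ} {ι : Type*} [Fintype ι] [Nonempty ι]
    {θ : ι → EuclideanSpace ℝ (Fin p)} {σ : ℝ} (hσ : 0 < σ)
    (hθ : ∀ i, σ⁻¹ • θ i ∈ alternatives p k r) {c : ℝ}
    (h : ∀ ψ ∈ tests n p, c ≤ ∫ z, ψ z ∂(obsLaw n p 0 1) +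
      (Fintype.card ι : ℝ)⁻¹ * ∑ i, ∫ z, (1 - ψ z) ∂(obsLaw n p (θ i) σ)) :
    c ≤ minimaxError n p k r := by
  have : Nonempty (tests n p) := ⟨⟨fun _ => 0, measurable_const, fun _ => by simp⟩⟩
  refine le_ciInf fun ⟨ψ, hψ⟩ => (h ψ hψ).trans (add_le_add ?_ ?_)
  · refine le_ciSup (f := fun σ : Set.Ioi (0 : ℝ) => ∫ z, ψ z ∂(obsLaw n p 0 σ)) ⟨1, ?_⟩
      (⟨1, Set.mem_Ioi.2 one_pos⟩ : Set.Ioi (0 : ℝ))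
    rintro _ ⟨σ, rfl⟩
    exact (integral_mem_Icc hψ.2).2
  · have h1 : ∀ i, ∫ z, (1 - ψ z) ∂(obsLaw n p (θ i) σ) ≤
        typeIIError ψ (alternatives p k r) := by
      intro i
      have := le_ciSup (f := fun q : alternatives p k r × Set.Ioi (0 : ℝ) => ∫ z, (1 - ψ z)
        ∂(obsLaw n p ((q.2 : ℝ) • (q.1 : EuclideanSpace ℝ (Fin p))) q.2)) ⟨1, by
          rintro _ ⟨q, rfl⟩
          exact (integral_mem_Icc (one_sub_mem_Icc hψ.2)).2⟩ (⟨σ⁻¹ • θ i, hθ i⟩, ⟨σ, hσ⟩)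
      simpa [typeIIError, smul_smul, mul_inv_cancel₀ hσ.ne'] using this
    have hN : (0 : ℝ) < Fintype.card ι := Nat.cast_pos.2 Fintype.card_pos
    rw [inv_mul_le_iff₀ hN]
    calc ∑ i, ∫ z, (1 - ψ z) ∂(obsLaw n p (θ i) σ)
        ≤ ∑ i : ι, typeIIError ψ (alternatives p k r) := Finset.sum_le_sum fun i _ => h1 i
      _ = _ := by simp

lemma norm_spike {p : ℕ} {h : ℝ} (hh : 0 ≤ h) (S : Finset (Fin p)) :
    ‖spike h S‖ = √S.card * h := by
  rw [EuclideanSpace.norm_eq]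
  have : ∀ j, ‖spike h S j‖ ^ 2 = if j ∈ S then h ^ 2 else 0 := by
    intro j; simp only [spike]; split_ifs <;> simp
  simp_rw [this]
  simp [Real.sqrt_sq hh]

lemma numNonzero_smul_spike_le {p : ℕ} (a h : ℝ) (S : Finset (Fin p)) :
    numNonzero (a • spike h S) ≤ S.card := by
  refine Finset.card_le_card fun j hj => ?_
  by_contra hS
  simp [spike, hS] at hj

lemma one_sub_sqrt_le_minimaxError {n p : ℕ} {k r h v : ℝ} {m : ℕ} {ι : Type*} [Fintype ι]
    [Nonempty ι] {S : ι → Finset (Fin p)} (hS : ∀ i, (S i).card = m) (hh : 0 ≤ h) (hv : 0 < v)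
    (hmk : (m : ℝ) ≤ k) (hr : r ≤ √m * h / √v)
    {A : ι → Set (Obs n p)} (hAm : ∀ i, MeasurableSet (A i)) {δ₁ δ₂ : ℝ} (hδ₁ : 0 ≤ δ₁)
    (hδ₂ : 0 ≤ δ₂) (hA : ∀ i, obsLaw n p (spike h (S i)) (√v) (A i)ᶜ ≤ ENNReal.ofReal δ₁)
    (h2 : ∀ i, ∑ j, ∫⁻ z, (A i).indicator (fun z => ENNReal.ofReal (likRatio v h (S i) z)) z *
      (A j).indicator (fun z => ENNReal.ofReal (likRatio v h (S j) z)) z ∂(refLaw n p) ≤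
        ENNReal.ofReal (Fintype.card ι * (1 + δ₂))) :
    1 - √(2 * δ₁ + δ₂) ≤ minimaxError n p k r := by
  have hσ := Real.sqrt_pos.2 hv
  refine le_minimaxError hσ (θ := fun i => spike h (S i)) (fun i => ⟨?_, ?_⟩) fun ψ hψ => ?_
  · refine le_trans ?_ hmk
    rw [← hS i]
    exact_mod_cast numNonzero_smul_spike_le _ _ _
  · rw [norm_smul, norm_spike hh, hS i, Real.norm_of_nonneg (inv_nonneg.2 hσ.le)]
    rwa [mul_comm, ← div_eq_mul_inv]
  · rw [obsLaw_zero_one]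
    refine one_sub_sqrt_le_error (fun i => measurable_likRatio v h (S i))
      (fun i => likRatio_nonneg v h (S i)) (fun i => ?_) hAm hδ₁ hδ₂ hA h2 hψ.1 hψ.2
    rw [obsLaw_spike _ _ hσ, Real.sq_sqrt hv.le]

/-! ### The block prior and its overlaps. -/

/-- The support that contains one coordinate from each of `m` blocks of size `q`. -/
def blockSupport {m q p : ℕ} (e : Fin m × Fin q ↪ Fin p) (J : Fin m → Fin q) : Finset (Fin p) :=
  Finset.univ.map ⟨fun b => e (b, J b), fun _ _ h => (Prod.ext_iff.1 (e.injective h)).1⟩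

lemma card_blockSupport {m q p : ℕ} (e : Fin m × Fin q ↪ Fin p) (J : Fin m → Fin q) :
    (blockSupport e J).card = m := by
  simp [blockSupport]

lemma card_blockSupport_inter {m q p : ℕ} (e : Fin m × Fin q ↪ Fin p) (J J' : Fin m → Fin q) :
    (blockSupport e J ∩ blockSupport e J').card =
      (Finset.univ.filter fun b => J b = J' b).card := by
  have : blockSupport e J ∩ blockSupport e J' = (Finset.univ.filter fun b => J b = J' b).map
      ⟨fun b => e (b, J b), fun _ _ h => (Prod.ext_iff.1 (e.injective h)).1⟩ := by
    ext a
    simp only [blockSupport, Finset.mem_inter, Finset.mem_map, Finset.mem_univ, true_and,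
      Finset.mem_filter]
    constructor
    · rintro ⟨⟨b, rfl⟩, b', hb'⟩
      obtain ⟨h1, h2⟩ := Prod.ext_iff.1 (e.injective hb')
      simp only at h1 h2
      subst h1
      exact ⟨b', h2.symm, rfl⟩
    · rintro ⟨b, hb, rfl⟩
      exact ⟨⟨b, rfl⟩, b, congrArg (fun i => e (b, i)) hb.symm⟩
  rw [this, Finset.card_map]

/-- The blocks are independent, so the sum factors over them; each factor is at most `q + exp c`,
hence at most `q * exp (exp c / q)`. -/
lemma sum_exp_agreements_le {m q : ℕ} (hq : 0 < q) (c : ℝ) (J : Fin m → Fin q) :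
    ∑ J' : Fin m → Fin q, Real.exp (c * (Finset.univ.filter fun b => J b = J' b).card) ≤
      (q : ℝ) ^ m * Real.exp (m * Real.exp c / q) := by
  have hq' : (0 : ℝ) < q := Nat.cast_pos.2 hq
  have h1 : ∀ J' : Fin m → Fin q, Real.exp (c * (Finset.univ.filter fun b => J b = J' b).card) =
      ∏ b, if J b = J' b then Real.exp c else 1 := by
    intro J'
    rw [Finset.prod_ite, Finset.prod_const, Finset.prod_const_one, mul_one, ← Real.exp_nat_mul,
      mul_comm]
  have h2 := Finset.prod_univ_sum (fun _ : Fin m => (Finset.univ : Finset (Fin q)))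
    (fun b i => if J b = i then Real.exp c else 1)
  rw [Fintype.piFinset_univ] at h2
  simp_rw [h1]
  rw [← h2]
  have h3 : ∀ b : Fin m, ∑ i : Fin q, (if J b = i then Real.exp c else 1) ≤
      q * Real.exp (Real.exp c / q) := by
    intro b
    calc ∑ i : Fin q, (if J b = i then Real.exp c else 1)
        ≤ ∑ i : Fin q, ((if J b = i then Real.exp c else 0) + 1) :=
          Finset.sum_le_sum fun i _ => by split_ifs <;> linarith
      _ = q * (Real.exp c / q + 1) := by
          rw [Finset.sum_add_distrib]; simp; field_simp
      _ ≤ _ := by gcongr; exact Real.add_one_le_exp _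
  calc ∏ b : Fin m, ∑ i : Fin q, (if J b = i then Real.exp c else 1)
      ≤ ∏ b : Fin m, (q * Real.exp (Real.exp c / q)) :=
        Finset.prod_le_prod (fun b _ => Finset.sum_nonneg fun i _ => by split_ifs <;> positivity)
          fun b _ => h3 b
    _ = _ := by
        rw [Finset.prod_const, Finset.card_univ, Fintype.card_fin, mul_pow, ← Real.exp_nat_mul]
        congr 2; ring

/-! ### Moments for `n` observations and non-asymptotic lower bounds. -/

lemma lintegral_likRatio_mul_likRatio {n p m : ℕ} {S S' : Finset (Fin p)} (hS : S.card = m)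
    (hS' : S'.card = m) {h v μ : ℝ} (hv : 0 < v) (hvm : v = 1 - m * h ^ 2)
    (hpos : 0 < 1 - μ ^ 2 * (S ∩ S').card +
      4 * h * μ * (S ∩ S').card / (1 - h ^ 2 * (S ∩ S').card)) :
    ∫⁻ z, ENNReal.ofReal (likRatio v h S z) * ENNReal.ofReal (likRatio v h S' z) *
        ENNReal.ofReal (Real.exp (-(μ * ∑ j ∈ S ∩ S', ∑ i, z.1 i j * z.2 i))) ∂(refLaw n p) =
      ENNReal.ofReal (((1 - h ^ 2 * (S ∩ S').card)⁻¹ * (√(1 - μ ^ 2 * (S ∩ S').card +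
        4 * h * μ * (S ∩ S').card / (1 - h ^ 2 * (S ∩ S').card)))⁻¹) ^ n) := by
  have hT : 0 ≤ 1 - h ^ 2 * (S ∩ S').card := by
    have : ((S ∩ S').card : ℝ) ≤ m := by
      rw [← hS]; exact_mod_cast Finset.card_le_card Finset.inter_subset_left
    nlinarith [sq_nonneg h]
  rw [ENNReal.ofReal_pow (mul_nonneg (inv_nonneg.2 hT) (by positivity)),
    ← lintegral_gaussRatio_mul_gaussRatio hS hS' hv hvm hpos]
  have := lintegral_prod_pi_prod (n := n) (Measure.pi fun _ : Fin p => gaussianReal 0 1)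
    (gaussianReal 0 1) (G := fun x y => ENNReal.ofReal (gaussRatio v (h * ∑ j ∈ S, x j) y) *
        ENNReal.ofReal (gaussRatio v (h * ∑ j ∈ S', x j) y) *
        ENNReal.ofReal (Real.exp (-(μ * y * ∑ j ∈ S ∩ S', x j)))) (by fun_prop)
  rw [← this, refLaw, designLaw]
  refine lintegral_congr fun z => ?_
  rw [Finset.prod_mul_distrib, Finset.prod_mul_distrib, likRatio, likRatio,
    ENNReal.ofReal_prod_of_nonneg fun _ _ => gaussRatio_nonneg _ _ _,
    ENNReal.ofReal_prod_of_nonneg fun _ _ => gaussRatio_nonneg _ _ _]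
  congr 1
  rw [← ENNReal.ofReal_prod_of_nonneg fun _ _ => (Real.exp_pos _).le, ← Real.exp_sum]
  congr 2
  rw [Finset.sum_comm, Finset.mul_sum, ← Finset.sum_neg_distrib]
  refine Finset.sum_congr rfl fun i _ => ?_
  rw [← Finset.sum_mul]; ring

lemma lintegral_likRatio_mul_exp {n p m : ℕ} {S : Finset (Fin p)} (hS : S.card = m)
    {h v μ : ℝ} (hv : 0 < v) (hvm : v = 1 - m * h ^ 2) {j : Fin p} (hj : j ∈ S)
    (hpos : 0 < 1 - 2 * h * μ - μ ^ 2 * (1 - h ^ 2)) :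
    ∫⁻ z, ENNReal.ofReal (likRatio v h S z) *
        ENNReal.ofReal (Real.exp (μ * ∑ i, z.1 i j * z.2 i)) ∂(refLaw n p) =
      ENNReal.ofReal (((√(1 - 2 * h * μ - μ ^ 2 * (1 - h ^ 2)))⁻¹) ^ n) := by
  rw [ENNReal.ofReal_pow (by positivity), ← lintegral_gaussRatio_mul_exp hS hv hvm hj hpos]
  have := lintegral_prod_pi_prod (n := n) (Measure.pi fun _ : Fin p => gaussianReal 0 1)
    (gaussianReal 0 1) (G := fun x y => ENNReal.ofReal (gaussRatio v (h * ∑ j ∈ S, x j) y) *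
        ENNReal.ofReal (Real.exp (μ * y * x j))) (by fun_prop)
  rw [← this, refLaw, designLaw]
  refine lintegral_congr fun z => ?_
  rw [Finset.prod_mul_distrib, likRatio,
    ENNReal.ofReal_prod_of_nonneg fun _ _ => gaussRatio_nonneg _ _ _]
  congr 1
  rw [← ENNReal.ofReal_prod_of_nonneg fun _ _ => (Real.exp_pos _).le, ← Real.exp_sum]
  congr 2
  rw [Finset.mul_sum]
  exact Finset.sum_congr rfl fun i _ => by ring

/-- The non-asymptotic lower bound for the uniform prior on block supports, where the likelihood
ratio is truncated to the sets `A J`. -/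
lemma one_sub_sqrt_le_minimaxError_blocks {n p m q : ℕ} (hq : 0 < q) (e : Fin m × Fin q ↪ Fin p)
    {k r h v : ℝ} (hh : 0 ≤ h) (hv : 0 < v) (hmk : (m : ℝ) ≤ k) (hr : r ≤ √m * h / √v)
    {A : (Fin m → Fin q) → Set (Obs n p)} (hAm : ∀ J, MeasurableSet (A J)) {δ c : ℝ} (hδ : 0 ≤ δ)
    (hA : ∀ J, obsLaw n p (spike h (blockSupport e J)) (√v) (A J)ᶜ ≤ ENNReal.ofReal δ)
    (h2 : ∀ J J', ∫⁻ z,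
      (A J).indicator (fun z => ENNReal.ofReal (likRatio v h (blockSupport e J) z)) z *
      (A J').indicator (fun z => ENNReal.ofReal (likRatio v h (blockSupport e J') z)) z
        ∂(refLaw n p) ≤
        ENNReal.ofReal (Real.exp (c * (blockSupport e J ∩ blockSupport e J').card))) :
    1 - √(2 * δ + (Real.exp (m * Real.exp c / q) - 1)) ≤ minimaxError n p k r := by
  have : Nonempty (Fin m → Fin q) := ⟨fun _ => ⟨0, hq⟩⟩
  have h0 : 0 ≤ Real.exp (m * Real.exp c / q) - 1 := by
    rw [sub_nonneg]; exact Real.one_le_exp (by positivity)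
  refine one_sub_sqrt_le_minimaxError (fun J => card_blockSupport e J) hh hv hmk hr hAm hδ h0 hA
    fun J => (Finset.sum_le_sum fun J' _ => h2 J J').trans ?_
  rw [← ENNReal.ofReal_sum_of_nonneg fun _ _ => (Real.exp_pos _).le]
  refine ENNReal.ofReal_le_ofReal ?_
  simp_rw [card_blockSupport_inter]
  refine (sum_exp_agreements_le hq c J).trans_eq ?_
  simp

lemma minimaxError_lower_bound {n p m q : ℕ} (hq : 0 < q) (hmq : m * q ≤ p)
    {k r h v : ℝ} (hh : 0 ≤ h) (hv : 0 < v) (hvm : v = 1 - m * h ^ 2) (hmk : (m : ℝ) ≤ k)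
    (hr : r ≤ √m * h / √v) {c : ℝ}
    (hc : ∀ T : ℕ, T ≤ m → ((1 - h ^ 2 * T)⁻¹) ^ n ≤ Real.exp (c * T)) :
    1 - √(Real.exp (m * Real.exp c / q) - 1) ≤ minimaxError n p k r := by
  have e : Fin m × Fin q ↪ Fin p := finProdFinEquiv.toEmbedding.trans (Fin.castLEEmb hmq)
  have := one_sub_sqrt_le_minimaxError_blocks (n := n) hq e hh hv hmk hr (A := fun _ => Set.univ)
    (fun _ => MeasurableSet.univ) (δ := 0) (c := c) le_rfl (by simp) fun J J' => ?_
  · simpa using this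
  · simp only [Set.indicator_univ]
    have h1 := lintegral_likRatio_mul_likRatio (n := n) (card_blockSupport e J)
      (card_blockSupport e J') (μ := 0) hv hvm (by norm_num)
    simp at h1
    rw [h1, ← inv_pow]
    refine ENNReal.ofReal_le_ofReal (hc _ ?_)
    exact (Finset.card_le_card Finset.inter_subset_left).trans_eq (card_blockSupport e J)

/-- Two Chernoff bounds with separate exponents: `μ` controls the truncated cross moments, and `μ'`,
with a union bound over the support, controls the mass lost by truncation. -/
lemma minimaxError_lower_bound_truncated {n p m q : ℕ} (hq : 0 < q) (hmq : m * q ≤ p)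
    {k r h v : ℝ} (hh : 0 ≤ h) (hv : 0 < v) (hvm : v = 1 - m * h ^ 2) (hmk : (m : ℝ) ≤ k)
    (hr : r ≤ √m * h / √v) {c δ μ μ' K : ℝ} (hμ : 0 ≤ μ) (hμ' : 0 ≤ μ')
    (hpos : ∀ T : ℕ, T ≤ m → 0 < 1 - μ ^ 2 * T + 4 * h * μ * T / (1 - h ^ 2 * T))
    (hc : ∀ T : ℕ, T ≤ m → ((1 - h ^ 2 * T)⁻¹ * (√(1 - μ ^ 2 * T +
        4 * h * μ * T / (1 - h ^ 2 * T)))⁻¹) ^ n * Real.exp (μ * K * T) ≤ Real.exp (c * T))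
    (hpos' : 0 < 1 - 2 * h * μ' - μ' ^ 2 * (1 - h ^ 2))
    (hδ : m * (((√(1 - 2 * h * μ' - μ' ^ 2 * (1 - h ^ 2)))⁻¹) ^ n * Real.exp (-(μ' * K))) ≤ δ) :
    1 - √(2 * δ + (Real.exp (m * Real.exp c / q) - 1)) ≤ minimaxError n p k r := by
  have e : Fin m × Fin q ↪ Fin p := finProdFinEquiv.toEmbedding.trans (Fin.castLEEmb hmq)
  have hδ0 : 0 ≤ δ := le_trans (by positivity) hδ
  -- Only sums over the support of `J` itself are truncated, since these are the ones shifted under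
  -- its alternative.
  set A : (Fin m → Fin q) → Set (Obs n p) := fun J =>
    {z | ∀ j ∈ blockSupport e J, ∑ i, z.1 i j * z.2 i ≤ K}
  have hAm : ∀ J, MeasurableSet (A J) := fun J => by
    have : A J = ⋂ j ∈ blockSupport e J, {z | ∑ i, z.1 i j * z.2 i ≤ K} := by
      ext z; simp [A]
    rw [this]
    exact Finset.measurableSet_biInter _ fun j _ => measurableSet_le (by fun_prop) (by fun_prop)
  refine one_sub_sqrt_le_minimaxError_blocks hq e hh hv hmk hr hAm hδ0 (fun J => ?_) fun J J' => ?_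
  · have hsub : (A J)ᶜ ⊆ ⋃ j ∈ blockSupport e J, {z | K < ∑ i, z.1 i j * z.2 i} := by
      intro z hz
      simpa [A] using hz
    have hj : ∀ j ∈ blockSupport e J,
        obsLaw n p (spike h (blockSupport e J)) (√v) {z | K < ∑ i, z.1 i j * z.2 i} ≤
        ENNReal.ofReal (((√(1 - 2 * h * μ' - μ' ^ 2 * (1 - h ^ 2)))⁻¹) ^ n *
          Real.exp (-(μ' * K))) := by
      intro j hj
      have hms : MeasurableSet {z : Obs n p | K < ∑ i, z.1 i j * z.2 i} :=
        measurableSet_lt (by fun_prop) (by fun_prop)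
      rw [obsLaw_spike _ _ (Real.sqrt_pos.2 hv), Real.sq_sqrt hv.le, withDensity_apply _ hms,
        ENNReal.ofReal_mul (by positivity),
        ← lintegral_likRatio_mul_exp (card_blockSupport e J) hv hvm hj hpos',
        ← lintegral_mul_const _ (by fun_prop), ← lintegral_indicator hms]
      refine lintegral_mono fun z => ?_
      by_cases hz : z ∈ {z : Obs n p | K < ∑ i, z.1 i j * z.2 i}
      · rw [Set.indicator_of_mem hz, mul_assoc, ← ENNReal.ofReal_mul (by positivity),
          ← Real.exp_add]
        refine le_mul_of_one_le_right zero_le ?_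
        rw [ENNReal.one_le_ofReal]
        refine Real.one_le_exp ?_
        have hz' : K < ∑ i, z.1 i j * z.2 i := hz
        nlinarith
      · rw [Set.indicator_of_notMem hz]; exact zero_le
    refine (measure_mono hsub).trans ((measure_biUnion_finset_le _ _).trans
      ((Finset.sum_le_sum hj).trans ?_))
    rw [Finset.sum_const, card_blockSupport, nsmul_eq_mul, ← ENNReal.ofReal_natCast,
      ← ENNReal.ofReal_mul (by positivity)]
    exact ENNReal.ofReal_le_ofReal hδ
  · have hT : (blockSupport e J ∩ blockSupport e J').card ≤ m :=
      (Finset.card_le_card Finset.inter_subset_left).trans_eq (card_blockSupport e J)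
    refine le_trans ?_ (ENNReal.ofReal_le_ofReal (hc _ hT))
    rw [ENNReal.ofReal_mul' (by positivity), ← lintegral_likRatio_mul_likRatio
      (card_blockSupport e J) (card_blockSupport e J') hv hvm (hpos _ hT),
      ← lintegral_mul_const _ (by fun_prop)]
    -- On the truncation sets the shared sums total at most `K * T`, so the exponential weight is at
    -- least one; elsewhere the left side vanishes.
    refine lintegral_mono fun z => ?_
    by_cases hz : z ∈ A J
    · by_cases hz' : z ∈ A J'
      · rw [Set.indicator_of_mem hz, Set.indicator_of_mem hz', mul_assoc,
          ← ENNReal.ofReal_mul (Real.exp_pos _).le, ← Real.exp_add]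
        refine le_mul_of_one_le_right zero_le ?_
        rw [ENNReal.one_le_ofReal]
        refine Real.one_le_exp ?_
        have : ∑ j ∈ blockSupport e J ∩ blockSupport e J', ∑ i, z.1 i j * z.2 i ≤
            ∑ j ∈ blockSupport e J ∩ blockSupport e J', K :=
          Finset.sum_le_sum fun j hj => hz j (Finset.mem_inter.1 hj).1
        rw [Finset.sum_const, nsmul_eq_mul] at this
        nlinarith
      · rw [Set.indicator_of_notMem hz', mul_zero]; exact zero_le
    · rw [Set.indicator_of_notMem hz, zero_mul]; exact zero_le

/-! ### Block sizes and passage to the limit. -/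

lemma one_le_sparsity {β : ℝ} (hβ' : β ≤ 1) {p : ℕ} (hp : 1 ≤ p) : 1 ≤ sparsity β p :=
  Real.one_le_rpow (by exact_mod_cast hp) (by linarith)

/-- With `m = ⌊k⌋` and `q = ⌊p / m⌋` one has `p ≤ 2 * m * q`, so `m / q ≤ 2 * m ^ 2 / p ≤ 2 * k ^ 2
/ p`. -/
lemma exists_block_size {β : ℝ} (hβ : 1 / 2 < β) (hβ' : β ≤ 1) {p : ℕ} (hp : 1 ≤ p) :
    ∃ m q : ℕ, 1 ≤ m ∧ 0 < q ∧ m * q ≤ p ∧ (m : ℝ) ≤ sparsity β p ∧ sparsity β p ≤ m + 1 ∧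
      (m : ℝ) / q ≤ 2 * (p : ℝ) ^ (1 - 2 * β) := by
  have hp' : (1 : ℝ) ≤ p := by exact_mod_cast hp
  have hk := one_le_sparsity hβ' hp
  have hkp : sparsity β p ≤ p := by
    calc sparsity β p ≤ (p : ℝ) ^ (1 : ℝ) := Real.rpow_le_rpow_of_exponent_le hp' (by linarith)
      _ = p := Real.rpow_one _
  set m := ⌊sparsity β p⌋₊
  have hm1 : 1 ≤ m := Nat.one_le_floor_iff _ |>.2 hk
  have hmk : (m : ℝ) ≤ sparsity β p := Nat.floor_le (by linarith)
  have hmp : m ≤ p := by exact_mod_cast hmk.trans hkp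
  have hq : 0 < p / m := Nat.div_pos hmp hm1
  refine ⟨m, p / m, hm1, hq, Nat.mul_div_le p m, hmk, (Nat.lt_floor_add_one _).le, ?_⟩
  have h1 : p ≤ 2 * (m * (p / m)) := by
    have := Nat.lt_mul_div_succ p hm1
    nlinarith
  have h2 : (p : ℝ) ≤ 2 * (m * (p / m : ℕ)) := by exact_mod_cast h1
  have hm0 : (0 : ℝ) < m := by exact_mod_cast hm1
  have hq0 : (0 : ℝ) < (p / m : ℕ) := by exact_mod_cast hq
  have hp0 : (0 : ℝ) < p := by linarith
  have h3 : (p : ℝ) ^ (1 - 2 * β) = sparsity β p ^ 2 / p := by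
    rw [sparsity, ← Real.rpow_natCast, ← Real.rpow_mul hp0.le, ← Real.rpow_sub_one hp0.ne']
    congr 1; push_cast; ring
  rw [h3, div_le_iff₀ hq0]
  have h4 : (m : ℝ) ^ 2 ≤ sparsity β p ^ 2 := by gcongr
  calc (m : ℝ) = m * p / p := by field_simp
    _ ≤ m * (2 * (m * (p / m : ℕ))) / p := by gcongr
    _ = 2 * (m ^ 2 / p) * (p / m : ℕ) := by ring
    _ ≤ _ := by gcongr

lemma tendsto_natCast_rpow_zero {p : ℕ → ℕ} (hp : Tendsto p atTop atTop) {b : ℝ} (hb : b < 0) :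
    Tendsto (fun l => (p l : ℝ) ^ b) atTop (𝓝 0) := by
  have := (tendsto_rpow_neg_atTop (neg_pos.2 hb)).comp (tendsto_natCast_atTop_atTop.comp hp)
  simpa [Function.comp_def] using this

lemma tendsto_minimaxError_of_lower_bound {n p : ℕ → ℕ} {k r : ℕ → ℝ}
    (hp : Tendsto p atTop atTop) {a b C : ℝ} (ha : a < 0) (hb : b < 0)
    (h : ∀ᶠ l in atTop, 1 - √(C * (p l : ℝ) ^ a + (Real.exp (2 * (p l : ℝ) ^ b) - 1)) ≤
      minimaxError (n l) (p l) (k l) (r l)) :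
    Tendsto (fun l => minimaxError (n l) (p l) (k l) (r l)) atTop (𝓝 1) := by
  refine tendsto_of_tendsto_of_tendsto_of_le_of_le' ?_ tendsto_const_nhds h
    (Eventually.of_forall fun l => minimaxError_le_one _ _ _ _)
  have h1 := (tendsto_natCast_rpow_zero hp ha).const_mul C
  have h2 := ((Real.continuous_exp.tendsto _).comp
    ((tendsto_natCast_rpow_zero hp hb).const_mul 2)).sub_const 1
  have h3 := ((Real.continuous_sqrt.tendsto _).comp (h1.add h2)).const_sub 1
  simpa [Function.comp_def] using h3

lemma mul_exp_div_le {β B c : ℝ} {m q p : ℕ} (hp : 1 ≤ p)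
    (hmq : (m : ℝ) / q ≤ 2 * (p : ℝ) ^ (1 - 2 * β)) (hc : c ≤ B * Real.log p) :
    m * Real.exp c / q ≤ 2 * (p : ℝ) ^ (1 - 2 * β + B) := by
  have hp0 : (0 : ℝ) < p := by exact_mod_cast hp
  have : Real.exp c ≤ (p : ℝ) ^ B := by
    rw [Real.rpow_def_of_pos hp0, mul_comm (Real.log _)]
    exact Real.exp_le_exp.2 hc
  calc m * Real.exp c / q = m / q * Real.exp c := by ring
    _ ≤ 2 * (p : ℝ) ^ (1 - 2 * β) * (p : ℝ) ^ B := by gcongr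
    _ = _ := by rw [mul_assoc, ← Real.rpow_add hp0]

/-! ### The regime of fixed radius. -/

theorem tendsto_minimaxError_fixed_radius {β : ℝ} (hβ : 1 / 2 < β) (hβ' : β ≤ 1) {n p : ℕ → ℕ}
    (hn : Tendsto n atTop atTop) (hp : Tendsto p atTop atTop)
    (h : Tendsto (fun l => sparsity β (p l) * Real.log (p l) / n l) atTop atTop)
    {r : ℝ} (hr : 0 < r) :
    Tendsto (fun l => minimaxError (n l) (p l) (sparsity β (p l)) r) atTop (𝓝 1) := by
  set B : ℝ := (2 * β - 1) / 2 with hB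
  have hB0 : 0 < B := by linarith
  set Λ := Real.log (1 + r ^ 2)
  have hb : 1 - 2 * β + B < 0 := by linarith
  -- Nothing is truncated here, so the first error term is absent: `C = 0`, and `a` is arbitrary.
  refine tendsto_minimaxError_of_lower_bound hp (a := -1) (C := 0) (by norm_num) hb ?_
  filter_upwards [h.eventually_ge_atTop (2 * Λ / B), hn.eventually_ge_atTop 1,
    hp.eventually_ge_atTop 1] with l h1 hn1 hp1
  obtain ⟨m, q, hm1, hq, hmqp, hmk, hkm, hmq⟩ := exists_block_size hβ hβ' hp1
  have hm0 : (1 : ℝ) ≤ m := by exact_mod_cast hm1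
  have hn0 : (0 : ℝ) < n l := by exact_mod_cast hn1
  have hlog : 0 ≤ Real.log (p l) := Real.log_natCast_nonneg _
  set v : ℝ := (1 + r ^ 2)⁻¹ with hv
  have hv0 : 0 < v := by positivity
  have hv1 : v ≤ 1 := inv_le_one_of_one_le₀ (by nlinarith)
  set h' : ℝ := √((1 - v) / m)
  have hh2 : h' ^ 2 = (1 - v) / m := Real.sq_sqrt (div_nonneg (by linarith) (by linarith))
  -- The factor two in `2 * Λ / B` pays for rounding: `k ≤ m + 1 ≤ 2 * m`.
  have hc : (n l : ℝ) * Λ / m ≤ B * Real.log (p l) := by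
    rw [div_le_div_iff₀ hB0 hn0] at h1
    rw [div_le_iff₀ (by linarith)]
    nlinarith [mul_nonneg hB0.le hlog]
  have hrr : r ≤ √m * h' / √v := by
    have : √m * h' / √v = √(m * ((1 - v) / m) / v) := by
      rw [Real.sqrt_div (by rw [← hh2]; positivity), Real.sqrt_mul (by linarith)]
    rw [this]
    apply Real.le_sqrt_of_sq_le
    apply le_of_eq
    rw [hv]; field_simp; ring
  have key := minimaxError_lower_bound (n := n l) hq hmqp (Real.sqrt_nonneg _) hv0
    (by rw [hh2]; field_simp; ring) hmk hrr (c := n l * Λ / m) fun T hT => ?_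
  · refine le_trans ?_ key
    gcongr
    rw [zero_mul, zero_add]
    gcongr
    exact mul_exp_div_le hp1 hmq hc
  · have hTm : (T : ℝ) ≤ m := by exact_mod_cast hT
    -- Bernoulli's inequality with exponent `T / m ≤ 1`: the convex function `-log (1 - h' ^ 2 * T)`
    -- of `T` lies below its chord from `0` to `m`, whose slope is `Λ / m`.
    have hb := rpow_one_add_le_one_add_mul_self (s := v - 1) (by linarith)
      (p := T / m) (by positivity) (by rw [div_le_one (by linarith)]; exact hTm)
    have e1 : 1 + T / m * (v - 1) = 1 - h' ^ 2 * T := by rw [hh2]; ring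
    rw [add_sub_cancel, e1] at hb
    have e2 : v ^ ((T : ℝ) / m) = Real.exp (-(Λ * (T / m))) := by
      rw [Real.rpow_def_of_pos hv0, hv, Real.log_inv]; congr 1; ring
    rw [e2] at hb
    calc ((1 - h' ^ 2 * T)⁻¹) ^ n l ≤ ((Real.exp (-(Λ * (T / m))))⁻¹) ^ n l := by
          have := Real.exp_pos (-(Λ * (T / m : ℝ)))
          have h2 : 0 < 1 - h' ^ 2 * (T : ℝ) := this.trans_le hb
          gcongr
      _ = Real.exp (n l * Λ / m * T) := by
          rw [← Real.exp_neg, ← Real.exp_nat_mul]; congr 1; ring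

/-! ### The regime below the detection boundary. -/

lemma eventually_le_of_hasDerivAt_zero {f : ℝ → ℝ} {d ε : ℝ} (hf : HasDerivAt f d 0)
    (h0 : f 0 = 0) (hε : 0 < ε) : ∀ᶠ w in 𝓝 (0 : ℝ), 0 ≤ w → f w ≤ (d + ε) * w := by
  have := (hasDerivAt_iff_isLittleO.1 hf).def hε
  filter_upwards [this] with w hw hw0
  simp only [h0, sub_zero, smul_eq_mul, Real.norm_eq_abs, abs_of_nonneg hw0] at hw
  have := (abs_le.1 hw).2
  linarith

/-- Here `w` stands for `T * log p / n`, with `h` and `μ` equal to `x` and `ℓ` times `√(log p / n)`.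
The exponent is the first-order expansion of the logarithm of the left side. Raising to the power
`n` turns `w` into `T * log p`. -/
lemma eventually_second_moment_bound (x ℓ : ℝ) {ε : ℝ} (hε : 0 < ε) :
    ∀ᶠ w in 𝓝 (0 : ℝ), 0 ≤ w → 0 < 1 - x ^ 2 * w ∧
      0 < 1 - ℓ ^ 2 * w + 4 * x * ℓ * w / (1 - x ^ 2 * w) ∧
      (1 - x ^ 2 * w)⁻¹ * (√(1 - ℓ ^ 2 * w + 4 * x * ℓ * w / (1 - x ^ 2 * w)))⁻¹ ≤
        Real.exp ((x ^ 2 + ℓ ^ 2 / 2 - 2 * x * ℓ + ε) * w) := by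
  have d1 : HasDerivAt (fun w : ℝ => 1 - x ^ 2 * w) (-x ^ 2) 0 := by
    simpa using ((hasDerivAt_id (0 : ℝ)).const_mul (x ^ 2)).const_sub 1
  have d2 : HasDerivAt (fun w : ℝ => 1 - ℓ ^ 2 * w + 4 * x * ℓ * w / (1 - x ^ 2 * w))
      (-ℓ ^ 2 + 4 * x * ℓ) 0 := by
    have a1 : HasDerivAt (fun w : ℝ => 1 - ℓ ^ 2 * w) (-ℓ ^ 2) 0 := by
      simpa using ((hasDerivAt_id (0 : ℝ)).const_mul (ℓ ^ 2)).const_sub 1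
    have a2 : HasDerivAt (fun w : ℝ => 4 * x * ℓ * w) (4 * x * ℓ) 0 := by
      simpa using (hasDerivAt_id (0 : ℝ)).const_mul (4 * x * ℓ)
    have a3 := a1.add (a2.div d1 (by simp))
    exact a3.congr_deriv (by simp)
  have d3 := (d1.log (by simp)).neg.sub ((d2.log (by simp)).div_const 2)
  have e1 := d1.continuousAt.eventually (lt_mem_nhds (a := 0) (by simp))
  have e2 := d2.continuousAt.eventually (lt_mem_nhds (a := 0) (by simp))
  have e3 := eventually_le_of_hasDerivAt_zero d3 (by simp) hε
  filter_upwards [e1, e2, e3] with w h1 h2 h3 hw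
  refine ⟨h1, h2, ?_⟩
  have h4 := h3 hw
  simp only [Pi.sub_apply, Pi.neg_apply] at h4
  have k1 : (1 - x ^ 2 * w)⁻¹ = Real.exp (-Real.log (1 - x ^ 2 * w)) := by
    rw [Real.exp_neg, Real.exp_log h1]
  have k2 := Real.exp_log (Real.sqrt_pos.2 h2)
  rw [Real.log_sqrt h2.le] at k2
  rw [k1, ← k2, ← Real.exp_neg, ← Real.exp_add, ← sub_eq_add_neg]
  exact Real.exp_le_exp.2 (h4.trans_eq (by ring))

/-- The analogous expansion of the moment generating function, with `w = log p / n`. -/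
lemma eventually_truncation_bound (x ℓ : ℝ) {ε : ℝ} (hε : 0 < ε) :
    ∀ᶠ w in 𝓝 (0 : ℝ), 0 ≤ w →
      0 < 1 - 2 * x * ℓ * w - ℓ ^ 2 * w * (1 - x ^ 2 * w) ∧
      (√(1 - 2 * x * ℓ * w - ℓ ^ 2 * w * (1 - x ^ 2 * w)))⁻¹ ≤
        Real.exp ((x * ℓ + ℓ ^ 2 / 2 + ε) * w) := by
  have d2 : HasDerivAt (fun w : ℝ => 1 - 2 * x * ℓ * w - ℓ ^ 2 * w * (1 - x ^ 2 * w))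
      (-(2 * x * ℓ) - ℓ ^ 2) 0 := by
    have d1 : HasDerivAt (fun w : ℝ => 1 - x ^ 2 * w) (-x ^ 2) 0 := by
      simpa using ((hasDerivAt_id (0 : ℝ)).const_mul (x ^ 2)).const_sub 1
    have a1 : HasDerivAt (fun w : ℝ => 1 - 2 * x * ℓ * w) (-(2 * x * ℓ)) 0 := by
      simpa using ((hasDerivAt_id (0 : ℝ)).const_mul (2 * x * ℓ)).const_sub 1
    have a2 : HasDerivAt (fun w : ℝ => ℓ ^ 2 * w) (ℓ ^ 2) 0 := by
      simpa using (hasDerivAt_id (0 : ℝ)).const_mul (ℓ ^ 2)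
    have a3 := a1.sub (a2.mul d1)
    exact a3.congr_deriv (by simp)
  have d3 := ((d2.log (by simp)).div_const 2).neg
  have e2 := d2.continuousAt.eventually (lt_mem_nhds (a := 0) (by simp))
  have e3 := eventually_le_of_hasDerivAt_zero d3 (by simp) hε
  filter_upwards [e2, e3] with w h2 h3 hw
  refine ⟨h2, ?_⟩
  have h4 := h3 hw
  simp only [Pi.neg_apply] at h4
  rw [← Real.exp_log (Real.sqrt_pos.2 h2), ← Real.exp_neg, Real.log_sqrt h2.le]
  exact Real.exp_le_exp.2 (h4.trans_eq (by ring))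

/-- Choice of the signal strength `x` and the Chernoff exponent `ℓ`. -/
lemma exists_strength_exponent {β y : ℝ} (hβ : 1 / 2 < β) (hβ' : β < 1)
    (hy : y < boundaryConst β) :
    ∃ x ℓ : ℝ, y < x ∧ 0 < x ∧ x ≤ √2 ∧ 0 ≤ ℓ ∧
      1 - 2 * β + (x ^ 2 + ℓ ^ 2 / 2 - 2 * x * ℓ + √2 * ℓ) < 0 ∧
      1 - β - (√2 - x) ^ 2 / 2 < 0 := by
  have h2 : √2 ^ 2 = (2 : ℝ) := Real.sq_sqrt (by norm_num)
  have h2pos : 0 < √(2 : ℝ) := by positivity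
  set s := √(1 - β) with hs
  have hs2 : s ^ 2 = 1 - β := Real.sq_sqrt (by linarith)
  have hs0 : 0 < s := Real.sqrt_pos.2 (by linarith)
  have final : ∀ x, x < √2 * (1 - s) → x ≤ √2 ∧ 1 - β - (√2 - x) ^ 2 / 2 < 0 := by
    intro x hx
    have : √2 * s < √2 - x := by linarith
    have h3 : (√2 * s) ^ 2 < (√2 - x) ^ 2 := by gcongr
    have : 0 < √2 * s := by positivity
    rw [mul_pow, h2, hs2] at h3
    constructor <;> linarith
  unfold boundaryConst at hy
  split_ifs at hy with hc
  · have hpos : 0 < √(2 * β - 1) := Real.sqrt_pos.2 (by linarith)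
    obtain ⟨x, hx1, hx2⟩ := exists_between (max_lt hy hpos)
    have hx0 : 0 < x := (le_max_right _ _).trans_lt hx1
    have hxs : x ^ 2 < 2 * β - 1 := (Real.lt_sqrt hx0.le).1 hx2
    have hs1 : s < 1 := by nlinarith
    -- The truncation must stay cheap in this range too; the comparison of the two boundary curves
    -- reduces to `(2 * s - 1) ^ 2 ≥ 0`.
    have hle : √(2 * β - 1) ≤ √2 * (1 - s) := by
      rw [Real.sqrt_le_left (by nlinarith), mul_pow, h2]
      nlinarith [sq_nonneg (2 * s - 1)]
    obtain ⟨f1, f2⟩ := final x (hx2.trans_le hle)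
    refine ⟨x, 0, (le_max_left _ _).trans_lt hx1, hx0, f1, le_rfl, ?_, f2⟩
    simp; linarith
  · push Not at hc
    have hs1 : s < 1 / 2 := by nlinarith
    have hlt : √2 / 2 < √2 * (1 - s) := by nlinarith
    obtain ⟨x, hx1, hx2⟩ := exists_between (max_lt hy hlt)
    have hx0 : √2 / 2 < x := (le_max_right _ _).trans_lt hx1
    obtain ⟨f1, f2⟩ := final x hx2
    -- This `ℓ` minimises the exponent, and is nonnegative because `x > √2 / 2`. The minimum is `1 -
    -- (√2 - x) ^ 2`, so the first condition becomes twice the second.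
    refine ⟨x, 2 * x - √2, (le_max_left _ _).trans_lt hx1, by linarith, f1, by linarith, ?_, f2⟩
    nlinarith

lemma mul_sqrt_le_div_sqrt {x y z k m g v : ℝ} (hxy : x ≤ y) (hy : 0 ≤ y) (hz : 0 ≤ z)
    (hk : 0 ≤ k) (hm : y ^ 2 * k ≤ z ^ 2 * m) (hv : 0 < v) (hv1 : v ≤ 1) :
    x * √(k * g) ≤ √m * (z * √g) / √v := by
  have s2 : y * √k ≤ z * √m := by
    rw [← Real.sqrt_sq hy, ← Real.sqrt_sq hz, ← Real.sqrt_mul (sq_nonneg _),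
      ← Real.sqrt_mul (sq_nonneg _)]
    exact Real.sqrt_le_sqrt (by simpa [Real.sqrt_sq hy, Real.sqrt_sq hz] using hm)
  calc x * √(k * g) ≤ y * √(k * g) := by gcongr
    _ = y * √k * √g := by rw [Real.sqrt_mul hk]; ring
    _ ≤ z * √m * √g := by gcongr
    _ = √m * (z * √g) := by ring
    _ ≤ _ := by
        rw [le_div_iff₀ (Real.sqrt_pos.2 hv)]
        exact mul_le_of_le_one_right (by positivity) (Real.sqrt_le_one.2 hv1)

theorem tendsto_minimaxError_below_boundary {β : ℝ} (hβ : 1 / 2 < β) (hβ' : β < 1) {n p : ℕ → ℕ}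
    (hn : Tendsto n atTop atTop) (hp : Tendsto p atTop atTop) {x : ℕ → ℝ} {y : ℝ}
    (hy : y < boundaryConst β) (hx : ∀ᶠ l in atTop, x l ≤ y)
    (h : (fun l => sparsity β (p l) * Real.log (p l)) =o[atTop] fun l => (n l : ℝ)) :
    Tendsto (fun l => minimaxError (n l) (p l) (sparsity β (p l))
      (x l * √(sparsity β (p l) * Real.log (p l) / n l))) atTop (𝓝 1) := by
  obtain ⟨x₁, ℓ, hyx, hx0, hx2, hℓ, hi, hii⟩ := exists_strength_exponent hβ hβ' hy
  obtain ⟨ε, hε, hε1, hε2⟩ : ∃ ε > 0,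
      1 - 2 * β + (x₁ ^ 2 + ℓ ^ 2 / 2 - 2 * x₁ * ℓ + √2 * ℓ) + ε < 0 ∧
      1 - β - (√2 - x₁) ^ 2 / 2 + ε < 0 := by
    obtain ⟨ε, h1, h2⟩ := exists_between (lt_min (neg_pos.2 hi) (neg_pos.2 hii))
    exact ⟨ε, h1, by linarith [h2.trans_le (min_le_left _ _)],
      by linarith [h2.trans_le (min_le_right _ _)]⟩
  -- The optimal Chernoff exponent: under the alternative the sums centre near `x₁ * √(n * log p)`,
  -- while the threshold is `√2 * √(n * log p)`.
  set ℓ' := √2 - x₁ with hℓ'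
  have hℓ'0 : 0 ≤ ℓ' := by linarith
  have h22 : √2 ^ 2 = (2 : ℝ) := Real.sq_sqrt (by norm_num)
  set B := x₁ ^ 2 + ℓ ^ 2 / 2 - 2 * x₁ * ℓ + ε + √2 * ℓ
  refine tendsto_minimaxError_of_lower_bound hp (a := 1 - β - ℓ' ^ 2 / 2 + ε) (C := 2)
    hε2 (b := 1 - 2 * β + B) (by simp only [B]; linarith) ?_
  obtain ⟨w₀, hw₀, hw⟩ := Metric.eventually_nhds_iff.1
    ((eventually_second_moment_bound x₁ ℓ hε).and (eventually_truncation_bound x₁ ℓ' hε))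
  -- `y` may be negative, and the comparison of radii below squares it.
  set y₀ := max y 0
  have hy₀ : y₀ < x₁ := max_lt hyx hx0
  have hy₀0 : 0 ≤ y₀ := le_max_right _ _
  have hy₀2 : y₀ ^ 2 < x₁ ^ 2 := by gcongr
  have hk : Tendsto (fun l => sparsity β (p l)) atTop atTop :=
    (tendsto_rpow_atTop (by linarith)).comp (tendsto_natCast_atTop_atTop.comp hp)
  -- The lower bound on `k` lets the slack between `y₀` and `x₁` absorb the rounding of `k` down to
  -- `m`: it gives `y₀ ^ 2 * k ≤ x₁ ^ 2 * m`.
  filter_upwards [hx, hn.eventually_ge_atTop 1, hp.eventually_ge_atTop 1, h.def (half_pos hw₀),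
    hk.eventually_ge_atTop (x₁ ^ 2 / (x₁ ^ 2 - y₀ ^ 2))] with l hxl hn1 hp1 ho hkl
  obtain ⟨m, q, hm1, hq, hmqp, hmk, hkm, hmq⟩ := exists_block_size hβ hβ'.le hp1
  have hm0 : (1 : ℝ) ≤ m := by exact_mod_cast hm1
  have hn0 : (0 : ℝ) < n l := by exact_mod_cast hn1
  have hp0 : (0 : ℝ) < p l := by exact_mod_cast hp1
  set G := Real.log (p l) with hG
  have hG0 : 0 ≤ G := Real.log_natCast_nonneg _
  set k := sparsity β (p l) with hkdef
  have hk1 : 1 ≤ k := one_le_sparsity hβ'.le hp1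
  set g := G / n l with hg
  have hg0 : 0 ≤ g := by positivity
  have hng : n l * g = G := by rw [hg]; field_simp
  have hkg : k * g < w₀ := by
    rw [Real.norm_of_nonneg (by positivity), Real.norm_of_nonneg hn0.le] at ho
    rw [hg, ← mul_div_assoc, div_lt_iff₀ hn0]
    nlinarith
  -- Since `k * log p / n` is small, the expansions apply uniformly to all overlaps `T ≤ m`.
  have hTw : ∀ T : ℕ, T ≤ m → dist (T * g) 0 < w₀ := by
    intro T hT
    have : (T : ℝ) ≤ m := by exact_mod_cast hT
    rw [Real.dist_eq, sub_zero, abs_of_nonneg (by positivity)]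
    exact lt_of_le_of_lt (mul_le_mul_of_nonneg_right (this.trans hmk) hg0) hkg
  have hsg : √g ^ 2 = g := Real.sq_sqrt hg0
  have hK : √g * (√2 * (n l * √g)) = √2 * G := by
    rw [← hng]; linear_combination (√2 * n l) * hsg
  have hD : ∀ T : ℝ, (x₁ * √g) ^ 2 * T = x₁ ^ 2 * (T * g) := fun T => by
    rw [mul_pow, hsg]; ring
  have hD2 : ∀ T : ℝ, (ℓ * √g) ^ 2 * T = ℓ ^ 2 * (T * g) := fun T => by
    rw [mul_pow, hsg]; ring
  have hD3 : ∀ T : ℝ, 4 * (x₁ * √g) * (ℓ * √g) * T = 4 * x₁ * ℓ * (T * g) := fun T => by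
    linear_combination (4 * x₁ * ℓ * T) * hsg
  have hD4 : 1 - 2 * (x₁ * √g) * (ℓ' * √g) - (ℓ' * √g) ^ 2 * (1 - (x₁ * √g) ^ 2) =
      1 - 2 * x₁ * ℓ' * g - ℓ' ^ 2 * g * (1 - x₁ ^ 2 * g) := by
    simp only [mul_pow, hsg]
    linear_combination (-2 * x₁ * ℓ') * hsg
  have hv : 0 < 1 - m * (x₁ * √g) ^ 2 := by
    have := ((hw (hTw m le_rfl)).1 (by positivity)).1
    rw [mul_comm, hD]; exact this
  have hv1 : 1 - m * (x₁ * √g) ^ 2 ≤ 1 := by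
    rw [sub_le_self_iff]; positivity
  have hr : x l * √(k * G / n l) ≤ √m * (x₁ * √g) / √(1 - m * (x₁ * √g) ^ 2) := by
    rw [mul_div_assoc]
    refine mul_sqrt_le_div_sqrt (hxl.trans (le_max_left _ _)) hy₀0 hx0.le (by linarith) ?_ hv hv1
    rw [div_le_iff₀ (by linarith)] at hkl
    nlinarith only [hkl, mul_le_mul_of_nonneg_left hkm (sq_nonneg x₁)]
  have hw1 := (hw (hTw 1 hm1)).2 (by positivity)
  rw [Nat.cast_one, one_mul] at hw1
  have key := minimaxError_lower_bound_truncated (n := n l) hq hmqp (h := x₁ * √g) (by positivity)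
    hv rfl hmk hr (c := B * G) (δ := (p l : ℝ) ^ (1 - β - ℓ' ^ 2 / 2 + ε)) (μ := ℓ * √g)
    (μ' := ℓ' * √g) (K := √2 * (n l * √g)) (by positivity) (by positivity)
    (fun T hT => ?_) (fun T hT => ?_) ?_ ?_
  · refine le_trans ?_ key
    gcongr
    exact mul_exp_div_le hp1 hmq le_rfl
  · rw [hD, hD2, hD3]
    exact ((hw (hTw T hT)).1 (by positivity)).2.1
  · rw [hD, hD2, hD3]
    obtain ⟨c1, c2, c3⟩ := (hw (hTw T hT)).1 (by positivity)
    calc _ ≤ Real.exp ((x₁ ^ 2 + ℓ ^ 2 / 2 - 2 * x₁ * ℓ + ε) * (T * g)) ^ n l *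
          Real.exp (ℓ * √g * (√2 * (n l * √g)) * T) := by gcongr
      _ = Real.exp (B * G * T) := by
          rw [← Real.exp_nat_mul, ← Real.exp_add]
          congr 1
          simp only [B]
          linear_combination (ℓ * T) * hK +
            ((x₁ ^ 2 + ℓ ^ 2 / 2 - 2 * x₁ * ℓ + ε) * T) * hng
  · rw [hD4]; exact hw1.1
  · rw [hD4]
    have e1 : (m : ℝ) ≤ Real.exp (G * (1 - β)) := by
      rw [← Real.rpow_def_of_pos hp0]; exact hmk
    rw [Real.rpow_def_of_pos hp0]
    calc _ ≤ Real.exp (G * (1 - β)) * (Real.exp ((x₁ * ℓ' + ℓ' ^ 2 / 2 + ε) * g) ^ n l *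
          Real.exp (-(ℓ' * √g * (√2 * (n l * √g))))) := by gcongr; exact hw1.2
      _ = _ := by
          rw [← Real.exp_nat_mul, ← Real.exp_add, ← Real.exp_add]
          congr 1
          rw [← hG]
          -- The Chernoff exponent is `x₁ * ℓ' + ℓ' ^ 2 / 2 - √2 * ℓ' = -ℓ' ^ 2 / 2`, by the
          -- definition of `ℓ'`.
          linear_combination (-ℓ') * hK + (x₁ * ℓ' + ℓ' ^ 2 / 2 + ε) * hng + G * ℓ' * hℓ'

end SparseDetection

theorem mainTheorem3 (β : ℝ) (hβ : 1 / 2 < β) (hβ' : β ≤ 1) (n p : ℕ → ℕ)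
    (hn : Tendsto n atTop atTop) (hp : Tendsto p atTop atTop) :
    (β < 1 → ∀ x : ℕ → ℝ,
      limsup (fun l => ((x l - SparseDetection.boundaryConst β : ℝ) : EReal)) atTop < 0 →
      (fun l => SparseDetection.sparsity β (p l) * Real.log (p l))
        =o[atTop] (fun l => (n l : ℝ)) →
      Tendsto (fun l => SparseDetection.minimaxError (n l) (p l)
          (SparseDetection.sparsity β (p l))
          (x l * √(SparseDetection.sparsity β (p l) * Real.log (p l) / n l)))
        atTop (𝓝 1)) ∧
    (Tendsto (fun l => SparseDetection.sparsity β (p l) * Real.log (p l) / n l) atTop atTop →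
      ∀ r : ℝ, 0 < r →
        Tendsto (fun l => SparseDetection.minimaxError (n l) (p l)
          (SparseDetection.sparsity β (p l)) r) atTop (𝓝 1)) := by
  refine ⟨fun hβ1 x hx h => ?_, fun h r hr =>
    SparseDetection.tendsto_minimaxError_fixed_radius hβ hβ' hn hp h hr⟩
  -- A real number strictly between the limsup and zero gives a uniform gap below the boundary.
  obtain ⟨b, hb1, hb2⟩ := EReal.lt_iff_exists_real_btwn.1 hx
  have hb0 : b < 0 := by exact_mod_cast hb2
  refine SparseDetection.tendsto_minimaxError_below_boundary hβ hβ1 hn hp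
    (y := SparseDetection.boundaryConst β + b) (by linarith) ?_ h
  filter_upwards [eventually_lt_of_limsup_lt hb1] with l hl
  have : x l - SparseDetection.boundaryConst β < b := EReal.coe_lt_coe_iff.1 hl
  linarith
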